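/- Let $d\ge 1$ and let $p:\mathbb{R}^d\to[1,\infty]$ be measurable such that $1/p$ (with $1/\infty:=0$) is globally log-Hölder continuous, i.e. there are $C>0$ and $c_\infty\in\mathbb{R}$ with $|1/p(x)-1/p(y)|\le C/\log(e+1/|x-y|)$ and $|1/p(x)-c_\infty|\le C/\log(e+|x|)$ for all $x,y\in\mathbb{R}^d$. Assume $p^-:=\operatorname{ess\,inf}p>1$ and put $p^*(\cdot):=p(\cdot)/(p(\cdot)-1)$ (equal to $1$ where $p=\infty$). For a measurable exponent $s:\mathbb{R}^d\to[1,\infty]$, let $L^{s(\cdot)}(\mathbb{R}^d)$ be the space of measurable $f:\mathbb{R}^d\to\mathbb{R}$ with $\int|\alpha f(x)|^{s(x)}dx<\infty$ for some $\alpha>0$ (where $t^\infty:=0$ for $t\le1$ and $t^\infty:=\infty$ for $t>1$), and put $\|f\|_{L^{s(\cdot)}}:=\inf\{\lambda>0:\int|f(x)/\lambda|^{s(x)}dx\le1\}$, also for $[0,\infty]$-valued $f$. Let $W^{1,p(\cdot)}(\mathbb{R}^d)$ be the space of $f\in L^{p(\cdot)}(\mathbb{R}^d)$ with weak gradient $Df$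 such that $|Df|\in L^{p(\cdot)}(\mathbb{R}^d)$. For $g\ge0$ measurable let $\|f\|_{L^r(\mathbb{R}^d,g)}:=(\int|f|^rg\,dx)^{1/r}$ if $r<\infty$, let $\|f\|_{L^\infty(\mathbb{R}^d,g)}:=\|f\|_\infty$ be the essential supremum with respect to Lebesgue measure, and let $L^r(\mathbb{R}^d,g)$ be the class of measurable $f$ with $\|f\|_{L^r(\mathbb{R}^d,g)}<\infty$. For $R\in(0,\infty)$ let $M_Ru(x)$ be the supremum of the means of $|u|$ over the closed balls $B(x;s)$ with $0<s\le R$, put $M_0u:=0$, and let $Mu(x)$ be the supremum over all $s>0$. (i) There is a constant $K_0>0$ depending only on $d$ such that for every locally integrable $f$ with locally integrable weak gradient there is a Lebesgue null set $N$ with $$|f(x)-f(y)|\le K_0|x-y|\{M_{2|x-y|}(Df)(x)+M_{2|x-y|}(Df)(y)\},\qquad x,y\in\mathbb{R}^d\setminus N. \tag{1}$$ (ii) There is a constant $A_{p(\cdot)}>0$ such that $$\|Mg\|_{L^{p(\cdot)}(\mathbb{R}^d)}\le A_{p(\cdot)}\|g\|_{L^{p(\cdot)}(\mathbb{R}^d)}\qquad\text{for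 all }g\in L^{p(\cdot)}(\mathbb{R}^d). \tag{2}$$ (iii) Let $X,\widehat X:\Omega\to\mathbb{R}^d$ be random variables on a probability space with densities $p_X,p_{\widehat X}$ with respect to Lebesgue measure, and suppose $p_X,p_{\widehat X}\in L^{p^*(\cdot)}(\mathbb{R}^d)$. Let $r\in(1,\infty]$, $f\in W^{1,p(\cdot)}(\mathbb{R}^d)\cap L^r(\mathbb{R}^d,p_X)\cap L^r(\mathbb{R}^d,p_{\widehat X})$ and $q\in(0,r)$, with $q/\infty:=0$. Then for every constant $K_0>0$ for which (1) holds for this $f$ outside some null set, and every constant $A_{p(\cdot)}>0$ for which (2) holds, $$\mathbb{E}\big[|f(X)-f(\widehat X)|^q\big]\le C\,\mathbb{E}\big[|X-\widehat X|^q\big]^{\frac{1-q/r}{q+1-q/r}}$$ with the finite constant $$C=(2K_0)^q+\big(\|f\|_{L^r(\mathbb{R}^d,p_X)}+\|f\|_{L^r(\mathbb{R}^d,p_{\widehat X})}\big)^q\Big(2A_{p(\cdot)}\{\|p_X\|_{L^{p^*(\cdot)}(\mathbb{R}^d)}+\|p_{\widehat X}\|_{L^{p^*(\cdot)}(\mathbb{R}^d)}\}\,\||Df|\|_{L^{p(\cdot)}(\mathbb{R}^d)}\Big)^{1-\frac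 qr}.$$ (Expectations take values in $[0,\infty]$.) -/

import Mathlib

open MeasureTheory Set
open scoped ENNReal

noncomputable section

namespace VariableExponent

/-- Euclidean space `ℝ^d`. -/
abbrev E (d : ℕ) : Type := EuclideanSpace ℝ (Fin d)

variable {d : ℕ}

/-- A variable exponent: a measurable function `p : ℝ^d → [1, ∞]`. -/
structure IsExponent (p : E d → ℝ≥0∞) : Prop where
  measurable : Measurable p
  one_le : ∀ x, 1 ≤ p x

/-- The power `t ^ q` for `t, q ∈ [0, ∞]`, with the usual convention for modulars that
`t ^ ∞ = 0` for `t ≤ 1` and `t ^ ∞ = ∞` for `t > 1`. -/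
def varPow (t q : ℝ≥0∞) : ℝ≥0∞ :=
  if q = ∞ then (if t ≤ 1 then 0 else ∞) else t ^ q.toReal

/-- The modular `u ↦ ∫ u(x) ^ p(x) dx`. -/
def modular (p u : E d → ℝ≥0∞) : ℝ≥0∞ :=
  ∫⁻ x, varPow (u x) (p x)

/-- The Luxemburg norm in `L^{p(·)}(ℝ^d)` of a function with values in `[0, ∞]`; it is applied to
absolute values of real functions, to densities and to maximal functions. -/
def varNorm (p u : E d → ℝ≥0∞) : ℝ≥0∞ :=
  sInf {l : ℝ≥0∞ | 0 < l ∧ l ≠ ∞ ∧ modular p (fun x => u x / l) ≤ 1}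

/-- Membership in `L^{p(·)}(ℝ^d)`. -/
def MemVarLp (p : E d → ℝ≥0∞) (f : E d → ℝ) : Prop :=
  AEMeasurable f volume ∧
    ∃ a : ℝ, 0 < a ∧ modular p (fun x => ENNReal.ofReal a * ‖f x‖ₑ) < ∞

/-- Local log-Hölder continuity (for `x = y` the inequality holds trivially). -/
def LocallyLogHolder (g : E d → ℝ) : Prop :=
  ∃ C : ℝ, 0 < C ∧ ∀ x y : E d,
    |g x - g y| ≤ C / Real.log (Real.exp 1 + 1 / ‖x - y‖)

/-- The log-Hölder decay condition. -/
def LogHolderDecay (g : E d → ℝ) : Prop :=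
  ∃ (gInf : ℝ) (C : ℝ), 0 < C ∧ ∀ x : E d,
    |g x - gInf| ≤ C / Real.log (Real.exp 1 + ‖x‖)

/-- The class `𝒫^log(ℝ^d)`: variable exponents `p` such that `1 / p` (with `1 / ∞ = 0`) is globally
log-Hölder continuous. -/
structure IsLogHolderExponent (p : E d → ℝ≥0∞) : Prop where
  isExponent : IsExponent p
  locallyLogHolder : LocallyLogHolder (fun x => ((p x)⁻¹).toReal)
  logHolderDecay : LogHolderDecay (fun x => ((p x)⁻¹).toReal)

/-- The dual exponent `p^*(·) = p(·) / (p(·) - 1)`, with `p^*(x) = 1` where `p(x) = ∞`. -/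
def dualExponent (p : E d → ℝ≥0∞) : E d → ℝ≥0∞ :=
  fun x => ENNReal.conjExponent (p x)

/-- `G = (D_1 f, …, D_d f)` is the vector of the weak partial derivatives of `f`. -/
structure HasWeakGradient (f : E d → ℝ) (G : E d → E d) : Prop where
  locallyIntegrable : LocallyIntegrable f volume
  locallyIntegrable_grad : LocallyIntegrable G volume
  integral_eq : ∀ φ : E d → ℝ, ContDiff ℝ (⊤ : ℕ∞) φ → HasCompactSupport φ → ∀ i : Fin d,
    ∫ x, f x * fderiv ℝ φ x (EuclideanSpace.single i 1) = - ∫ x, G x i * φ x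

/-- Membership in the Sobolev space `W^{1,p(·)}(ℝ^d)`. -/
def MemSobolev (p : E d → ℝ≥0∞) (f : E d → ℝ) : Prop :=
  MemVarLp p f ∧ ∃ G : E d → E d, HasWeakGradient f G ∧ MemVarLp p (fun x => ‖G x‖)

/-- The norm of `L^r(ℝ^d, g)` for `r ∈ [1, ∞]`, that is `(∫ |f|^r g dx)^{1/r}` if `r < ∞` and the
essential supremum of `|f|` with respect to Lebesgue measure if `r = ∞`. -/
def weightedNorm (r : ℝ≥0∞) (g : E d → ℝ) (f : E d → ℝ) : ℝ≥0∞ :=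
  if r = ∞ then essSup (fun x => ‖f x‖ₑ) volume
  else (∫⁻ x, ‖f x‖ₑ ^ r.toReal * ENNReal.ofReal (g x)) ^ (1 / r.toReal)

/-- Membership in `L^r(ℝ^d, g)`. -/
def MemWeightedLp (r : ℝ≥0∞) (g : E d → ℝ) (f : E d → ℝ) : Prop :=
  AEMeasurable f volume ∧ weightedNorm r g f < ∞

/-- The mean of `u` over the closed ball `B(x; s)`. -/
def ballMean (u : E d → ℝ≥0∞) (x : E d) (s : ℝ) : ℝ≥0∞ :=
  (∫⁻ z in Metric.closedBall x s, u z) / volume (Metric.closedBall x s)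

/-- The Hardy--Littlewood maximal function `M u`. -/
def maximal (u : E d → ℝ≥0∞) (x : E d) : ℝ≥0∞ :=
  ⨆ (s : ℝ) (_ : 0 < s), ballMean u x s

/-- The restricted maximal function `M_R u`. -/
def restrictedMaximal (R : ℝ) (u : E d → ℝ≥0∞) (x : E d) : ℝ≥0∞ :=
  ⨆ (s : ℝ) (_ : 0 < s) (_ : s ≤ R), ballMean u x s

/-- `K` is a constant in the pointwise estimate
`|f(x) - f(y)| ≤ K |x - y| (M_{2|x-y|}(Df)(x) + M_{2|x-y|}(Df)(y))` for all `x, y` outside a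
Lebesgue null set, where `G = Df`. -/
def IsPointwiseConstant (f : E d → ℝ) (G : E d → E d) (K : ℝ) : Prop :=
  0 < K ∧ ∃ N : Set (E d), MeasurableSet N ∧ volume N = 0 ∧ ∀ x ∉ N, ∀ y ∉ N,
    ENNReal.ofReal |f x - f y| ≤ ENNReal.ofReal (K * ‖x - y‖) *
      (restrictedMaximal (2 * ‖x - y‖) (fun z => ‖G z‖ₑ) x +
        restrictedMaximal (2 * ‖x - y‖) (fun z => ‖G z‖ₑ) y)

/-- `A` is a constant in the maximal inequality
`‖M g‖_{L^{p(·)}} ≤ A ‖g‖_{L^{p(·)}}` for all `g ∈ L^{p(·)}(ℝ^d)`. -/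
def IsMaximalConstant (p : E d → ℝ≥0∞) (A : ℝ) : Prop :=
  0 < A ∧ ∀ g : E d → ℝ, MemVarLp p g →
    varNorm p (maximal (fun z => ‖g z‖ₑ)) ≤ ENNReal.ofReal A * varNorm p (fun z => ‖g z‖ₑ)

/-- The random variable `X` admits the density function `g : ℝ^d → [0, ∞)` with respect to
Lebesgue measure. -/
structure HasDensity {Ω : Type*} [MeasurableSpace Ω] (P : Measure Ω) (X : Ω → E d)
    (g : E d → ℝ) : Prop where
  measurable : Measurable X
  aemeasurable_density : AEMeasurable g volume
  nonneg : ∀ x, 0 ≤ g x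
  map_eq : Measure.map X P = volume.withDensity (fun x => ENNReal.ofReal (g x))

/-- The number `1 - q / r`, with `q / ∞ = 0`. -/
def theta (q : ℝ) (r : ℝ≥0∞) : ℝ :=
  1 - (ENNReal.ofReal q / r).toReal

/-- The constant
`(2 K)^q + (‖f‖_{L^r(g₁)} + ‖f‖_{L^r(g₂)})^q
  (2 A (‖g₁‖_{L^{p^*(·)}} + ‖g₂‖_{L^{p^*(·)}}) ‖|Df|‖_{L^{p(·)}})^{1 - q/r}`, where `G = Df`. -/
def avikainenConstant (K A q : ℝ) (r : ℝ≥0∞) (p : E d → ℝ≥0∞) (f : E d → ℝ) (G : E d → E d)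
    (g₁ g₂ : E d → ℝ) : ℝ≥0∞ :=
  ENNReal.ofReal (2 * K) ^ q +
    (weightedNorm r g₁ f + weightedNorm r g₂ f) ^ q *
      (2 * ENNReal.ofReal A *
        (varNorm (dualExponent p) (fun x => ‖g₁ x‖ₑ) +
          varNorm (dualExponent p) (fun x => ‖g₂ x‖ₑ)) *
        varNorm p (fun x => ‖G x‖ₑ)) ^ theta q r

end VariableExponent

end

open VariableExponent

/-! Write `G` for the weak gradient, `M` for the maximal function of `|G|`, `δ` for the `q`-th
moment of `X - X'`, and `θ = 1 - q/r`. Split the probability space at a level `L`. Where `M(X)` and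
`M(X')` are both at most `L`, the pointwise estimate bounds `|f(X) - f(X')|` by `2 K₀ L |X - X'|`,
contributing at most `(2 K₀)^q L^q δ`. By Markov, Hölder against the densities and the maximal
inequality, the complement has probability at most `Q / L`, where `Q` is the second base in
`avikainenConstant`; Hölder with exponent `r/q` then bounds its contribution by a multiple of `(Q /
L)^θ`. The choice `L = δ^(-1/(q+θ))` balances `L^q δ` and `L^(-θ)` (`lintegral_enorm_sub_rpow_le`).

Pointwise estimate: for smooth `f`, average `|f(x) - f(z)| + |f(y) - f(z)|` over `z` in a ball about
the midpoint of `x` and `y`, integrating the gradient along segments. For weakly differentiable `f`,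
mollify: the maximal function of the mollified gradient is controlled by that of `G` with doubled
radius, uniformly in the scale, and the mollifications converge almost everywhere.

Maximal inequality: fix `1 < s < ∞` with `s ≤ ess inf p`. For `u` of modular at most 1, log-Hölder
continuity allows the exponent at `y` to be replaced by the one at `x`, up to an integrable error
weight; thus `Mu(x)^{p(x)}` is bounded, up to constants, by the `s`-th power of a maximal function
of `u^{p/s}` plus that weight (`exists_ballMean_le_mul_rpow`). The classical `L^s` bound, obtained
from a Vitali covering, finishes. -/

namespace VariableExponent

/-! ### The Hardy–Littlewood maximal function on `L^s`, constant `s` -/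

section MaximalFunction

open Metric Filter Topology

variable {d : ℕ}

theorem volume_closedBall_eq (x : E d) {r : ℝ} (hr : 0 ≤ r) :
    volume (closedBall x r) = ENNReal.ofReal (r ^ d) * volume (closedBall (0 : E d) 1) := by
  rw [Measure.addHaar_closedBall' volume x hr, finrank_euclideanSpace_fin]

theorem volume_closedBall_mul (x y : E d) {c r : ℝ} (hc : 0 ≤ c) (hr : 0 ≤ r) :
    volume (closedBall x (c * r)) = ENNReal.ofReal (c ^ d) * volume (closedBall y r) := by
  rw [volume_closedBall_eq x (mul_nonneg hc hr), volume_closedBall_eq y hr, mul_pow,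
    ENNReal.ofReal_mul (pow_nonneg hc d), mul_assoc]

theorem volume_closedBall_ne_zero (x : E d) {r : ℝ} (hr : 0 < r) :
    volume (closedBall x r) ≠ 0 :=
  (measure_closedBall_pos volume x hr).ne'

theorem volume_closedBall_ne_top (x : E d) (r : ℝ) : volume (closedBall x r) ≠ ∞ :=
  measure_closedBall_lt_top.ne

theorem ballMean_le_maximal (u : E d → ℝ≥0∞) (x : E d) {s : ℝ} (hs : 0 < s) :
    ballMean u x s ≤ maximal u x :=
  le_iSup₂ (f := fun (s : ℝ) (_ : 0 < s) => ballMean u x s) s hs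

theorem ballMean_le_restrictedMaximal (u : E d → ℝ≥0∞) (x : E d) {s R : ℝ} (hs : 0 < s)
    (hR : s ≤ R) : ballMean u x s ≤ restrictedMaximal R u x :=
  le_iSup₂_of_le s hs (le_iSup_of_le hR le_rfl)

theorem restrictedMaximal_le_maximal (R : ℝ) (u : E d → ℝ≥0∞) (x : E d) :
    restrictedMaximal R u x ≤ maximal u x :=
  iSup₂_le fun _ hs => iSup_le fun _ => ballMean_le_maximal u x hs

theorem ballMean_mono_ae {u v : E d → ℝ≥0∞} (h : u ≤ᵐ[volume] v) (x : E d) (s : ℝ) :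
    ballMean u x s ≤ ballMean v x s :=
  ENNReal.div_le_div_right (lintegral_mono_ae (ae_restrict_of_ae h)) _

theorem maximal_mono_ae {u v : E d → ℝ≥0∞} (h : u ≤ᵐ[volume] v) (x : E d) :
    maximal u x ≤ maximal v x :=
  iSup₂_mono fun s _ => ballMean_mono_ae h x s

theorem ballMean_const_mul {u : E d → ℝ≥0∞} {c : ℝ≥0∞} (hc : c ≠ ∞) (x : E d) (s : ℝ) :
    ballMean (fun z => c * u z) x s = c * ballMean u x s := by
  unfold ballMean
  rw [lintegral_const_mul' _ _ hc, mul_div_assoc]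

theorem maximal_const_mul {u : E d → ℝ≥0∞} {c : ℝ≥0∞} (hc : c ≠ ∞) (x : E d) :
    maximal (fun z => c * u z) x = c * maximal u x := by
  simp only [maximal, ballMean_const_mul hc, ENNReal.mul_iSup]

/-- If the mean over `B(x;s)` exceeds `t`, so does the same integral divided by the volume of a
slightly larger `B(x;r)`; and `B(y;r)` contains `B(x;s)` when `|x - y| < r - s`. No measurability of
`u` is needed. -/
theorem isOpen_lt_maximal (u : E d → ℝ≥0∞) (t : ℝ≥0∞) : IsOpen {x | t < maximal u x} := by
  rw [Metric.isOpen_iff]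
  intro x hx
  simp only [mem_ofPred_eq, maximal, lt_iSup_iff] at hx
  obtain ⟨s, hs, hlt⟩ := hx
  set I := ∫⁻ z in closedBall x s, u z with hI
  have hcont : Tendsto (fun r : ℝ => I / volume (closedBall x r)) (𝓝[>] s)
      (𝓝 (I / volume (closedBall x s))) := by
    refine ENNReal.Tendsto.const_div ?_ (Or.inl (volume_closedBall_ne_top x s))
    have h1 : Tendsto (fun r : ℝ => ENNReal.ofReal (r ^ d) * volume (closedBall (0 : E d) 1))
        (𝓝[>] s) (𝓝 (ENNReal.ofReal (s ^ d) * volume (closedBall (0 : E d) 1))) := by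
      refine ENNReal.Tendsto.mul_const ?_ (Or.inr (volume_closedBall_ne_top _ _))
      exact ENNReal.tendsto_ofReal (((continuous_pow d).tendsto s).mono_left nhdsWithin_le_nhds)
    rw [volume_closedBall_eq x hs.le]
    refine h1.congr' ?_
    filter_upwards [self_mem_nhdsWithin] with r hr
    rw [volume_closedBall_eq x (hs.trans hr).le]
  obtain ⟨r, hr, hsr⟩ := ((hcont.eventually (lt_mem_nhds hlt)).and self_mem_nhdsWithin).exists
  have hsr' : s < r := hsr
  refine ⟨r - s, sub_pos.2 hsr', fun y hy => ?_⟩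
  refine lt_of_lt_of_le hr (le_trans ?_ (ballMean_le_maximal u y (hs.trans hsr')))
  unfold ballMean
  rw [volume_closedBall_eq y (hs.trans hsr').le, volume_closedBall_eq x (hs.trans hsr').le]
  refine ENNReal.div_le_div_right (lintegral_mono_set ?_) _
  refine closedBall_subset_closedBall' ?_
  rw [mem_ball] at hy
  rw [dist_comm]
  linarith

theorem measurable_maximal (u : E d → ℝ≥0∞) : Measurable (maximal u) :=
  measurable_of_Ioi fun t => (isOpen_lt_maximal u t).measurableSet

/-- The weak type `(1, 1)` estimate. -/
theorem mul_volume_lt_maximal_le (hd : 1 ≤ d) (u : E d → ℝ≥0∞) (t : ℝ≥0∞) :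
    t * volume {x | t < maximal u x} ≤ ENNReal.ofReal (4 ^ d) * ∫⁻ x, u x := by
  rcases eq_or_ne t 0 with rfl | ht0
  · simp
  rcases eq_or_ne t ∞ with rfl | htop
  · simp
  rcases eq_or_ne (∫⁻ x, u x) ∞ with hI | hI
  · rw [hI, ENNReal.mul_top (by simp)]
    exact le_top
  set A := {x | t < maximal u x} with hA
  have key : ∀ x ∈ A, ∃ s : ℝ, 0 < s ∧
      t * volume (closedBall x s) ≤ ∫⁻ z in closedBall x s, u z := by
    intro x hx
    simp only [hA, mem_ofPred_eq, maximal, lt_iSup_iff] at hx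
    obtain ⟨s, hs, hlt⟩ := hx
    exact ⟨s, hs, ENNReal.mul_le_of_le_div hlt.le⟩
  choose! s hs0 hs using key
  set V := volume (closedBall (0 : E d) 1) with hV
  have hV0 : V ≠ 0 := volume_closedBall_ne_zero _ one_pos
  have hVt : V ≠ ∞ := volume_closedBall_ne_top _ _
  -- Vitali's lemma needs bounded radii: `t |B(x;s)| ≤ ∫ u < ∞` bounds `s ^ d`, hence `s`, because
  -- `d ≥ 1`. The enlargement factor 4 used below (anything above 3 would do) gives `4 ^ d`.
  have hbound : ∀ x ∈ A, s x ≤ max 1 ((∫⁻ x, u x) / (t * V)).toReal := by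
    intro x hx
    have h1 : ENNReal.ofReal (s x ^ d) ≤ (∫⁻ x, u x) / (t * V) := by
      rw [ENNReal.le_div_iff_mul_le (Or.inl (mul_ne_zero ht0 hV0))
        (Or.inl (ENNReal.mul_ne_top htop hVt))]
      calc ENNReal.ofReal (s x ^ d) * (t * V) = t * volume (closedBall x (s x)) := by
            rw [volume_closedBall_eq x (hs0 x hx).le]; ring
        _ ≤ _ := (hs x hx).trans (setLIntegral_le_lintegral _ _)
    have h2 : s x ^ d ≤ ((∫⁻ x, u x) / (t * V)).toReal :=
      (ENNReal.ofReal_le_iff_le_toReal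
        (ENNReal.div_ne_top hI (mul_ne_zero ht0 hV0))).1 h1
    rcases le_total (s x) 1 with h | h
    · exact h.trans (le_max_left _ _)
    · exact ((le_self_pow₀ h (by omega)).trans h2).trans (le_max_right _ _)
  obtain ⟨B, hBA, hdisj, hcov⟩ := Vitali.exists_disjoint_subfamily_covering_enlargement_closedBall
    A (fun x => x) s _ hbound 4 (by norm_num)
  have hBc : B.Countable := hdisj.countable_of_nonempty_interior fun x hx =>
    ⟨x, ball_subset_interior_closedBall (mem_ball_self (hs0 x (hBA hx)))⟩
  have hsub : A ⊆ ⋃ b ∈ B, closedBall b (4 * s b) := fun x hx => by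
    obtain ⟨b, hb, hxb⟩ := hcov x hx
    exact mem_biUnion hb (hxb (mem_closedBall_self (hs0 x hx).le))
  have : Countable B := hBc.to_subtype
  calc t * volume A ≤ t * ∑' b : B, volume (closedBall (b : E d) (4 * s b)) := by
        gcongr
        exact (measure_mono hsub).trans (measure_biUnion_le volume hBc _)
    _ = ENNReal.ofReal (4 ^ d) * ∑' b : B, t * volume (closedBall (b : E d) (s b)) := by
        rw [← ENNReal.tsum_mul_left, ← ENNReal.tsum_mul_left]
        refine tsum_congr fun b => ?_
        rw [volume_closedBall_mul (b : E d) (b : E d) (by norm_num) (hs0 b (hBA b.2)).le]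
        ring
    _ ≤ ENNReal.ofReal (4 ^ d) * ∑' b : B, ∫⁻ z in closedBall (b : E d) (s b), u z := by
        gcongr with b
        exact hs b (hBA b.2)
    _ = ENNReal.ofReal (4 ^ d) * ∫⁻ z in ⋃ b ∈ B, closedBall (b : E d) (s b), u z := by
        rw [lintegral_biUnion hBc (fun _ _ => isClosed_closedBall.measurableSet) hdisj]
    _ ≤ _ := by
        gcongr
        exact Measure.restrict_le_self

/-- Layer cake for a single number: the indicator cuts the half-line down to `(0, a)`. Comparing
inside `[0, ∞]` lets the same integrand serve infinite values later. -/
theorem lintegral_rpow_indicator_lt {c : ℝ} (hc : 0 < c) {a : ℝ} (ha : 0 ≤ a) :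
    ∫⁻ t in Ioi (0 : ℝ), {t : ℝ | ENNReal.ofReal t < ENNReal.ofReal a}.indicator
      (fun t => ENNReal.ofReal (t ^ (c - 1))) t = ENNReal.ofReal (a ^ c / c) := by
  have hset : {t : ℝ | ENNReal.ofReal t < ENNReal.ofReal a} ∩ Ioi 0 = Ioo 0 a := by
    ext t
    simp only [mem_inter_iff, mem_ofPred_eq, mem_Ioi, mem_Ioo]
    constructor
    · rintro ⟨h, h0⟩
      exact ⟨h0, (ENNReal.ofReal_lt_ofReal_iff_of_nonneg h0.le).1 h⟩
    · rintro ⟨h0, h⟩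
      exact ⟨(ENNReal.ofReal_lt_ofReal_iff_of_nonneg h0.le).2 h, h0⟩
  have hmeas : MeasurableSet {t : ℝ | ENNReal.ofReal t < ENNReal.ofReal a} :=
    measurableSet_lt ENNReal.measurable_ofReal measurable_const
  rw [lintegral_indicator hmeas, Measure.restrict_restrict hmeas, hset,
    restrict_Ioo_eq_restrict_Ioc]
  have hint := intervalIntegral.intervalIntegrable_rpow' (a := 0) (b := a)
    (show -1 < c - 1 by linarith)
  rw [← ofReal_integral_eq_lintegral_ofReal
    ((intervalIntegrable_iff_integrableOn_Ioc_of_le ha).1 hint)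
    ((ae_restrict_iff' measurableSet_Ioc).2 (ae_of_all _ fun t ht => Real.rpow_nonneg ht.1.le _)),
    ← intervalIntegral.integral_of_le ha, integral_rpow (Or.inl (by linarith))]
  simp [Real.zero_rpow hc.ne']

theorem rpow_le_lintegral_indicator_lt {c : ℝ} (hc : 0 < c) (a : ℝ≥0∞) :
    a ^ c ≤ ENNReal.ofReal c * ∫⁻ t in Ioi (0 : ℝ), {t : ℝ | ENNReal.ofReal t < a}.indicator
      (fun t => ENNReal.ofReal (t ^ (c - 1))) t := by
  have hfin : ∀ b : ℝ, 0 ≤ b → ENNReal.ofReal b ≤ a → ENNReal.ofReal b ^ c ≤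
      ENNReal.ofReal c * ∫⁻ t in Ioi (0 : ℝ), {t : ℝ | ENNReal.ofReal t < a}.indicator
      (fun t => ENNReal.ofReal (t ^ (c - 1))) t := by
    intro b hb hba
    calc ENNReal.ofReal b ^ c = ENNReal.ofReal c * ENNReal.ofReal (b ^ c / c) := by
          rw [← ENNReal.ofReal_mul hc.le, ENNReal.ofReal_rpow_of_nonneg hb hc.le,
            mul_div_cancel₀ _ hc.ne']
      _ ≤ _ := by
          rw [← lintegral_rpow_indicator_lt hc hb]
          gcongr with t
  rcases eq_or_ne a ∞ with rfl | ha
  · have hlim : Tendsto (fun n : ℕ => ENNReal.ofReal (n : ℝ) ^ c) atTop (𝓝 (∞ ^ c)) := by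
      refine (ENNReal.continuous_rpow_const.tendsto _).comp ?_
      simpa using ENNReal.tendsto_nat_nhds_top
    exact le_of_tendsto' hlim fun n => hfin n n.cast_nonneg le_top
  · simpa [ENNReal.ofReal_toReal ha] using hfin a.toReal ENNReal.toReal_nonneg
      (ENNReal.ofReal_toReal ha).le

theorem lintegral_indicator_lt_le_rpow {c : ℝ} (hc : 0 < c) (a : ℝ≥0∞) :
    ENNReal.ofReal c * ∫⁻ t in Ioi (0 : ℝ), {t : ℝ | ENNReal.ofReal t < a}.indicator
      (fun t => ENNReal.ofReal (t ^ (c - 1))) t ≤ a ^ c := by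
  rcases eq_or_ne a ∞ with rfl | ha
  · rw [ENNReal.top_rpow_of_pos hc]
    exact le_top
  · have h := lintegral_rpow_indicator_lt hc (a := a.toReal) ENNReal.toReal_nonneg
    rw [ENNReal.ofReal_toReal ha] at h
    rw [h, ← ENNReal.ofReal_mul hc.le, mul_div_cancel₀ _ hc.ne',
      ← ENNReal.ofReal_rpow_of_nonneg ENNReal.toReal_nonneg hc.le, ENNReal.ofReal_toReal ha]

/-- Keep only the part `w` of `u` above height `t/2`. What is discarded raises the maximal function
by at most `t/2`, so the weak type bound for `w` at level `t/2` suffices. -/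
theorem volume_lt_maximal_le_lintegral_indicator (hd : 1 ≤ d) (u : E d → ℝ≥0∞) {t : ℝ}
    (ht : 0 < t) :
    ENNReal.ofReal t * volume {x | ENNReal.ofReal t < maximal u x} ≤
      2 * ENNReal.ofReal (4 ^ d) *
        ∫⁻ x, {x | ENNReal.ofReal t < 2 * u x}.indicator u x := by
  set τ := ENNReal.ofReal (t / 2) with hτ
  have h2τ : τ + τ = ENNReal.ofReal t := by
    rw [hτ, ← ENNReal.ofReal_add (by positivity) (by positivity), add_halves]
  set w : E d → ℝ≥0∞ := {x | ENNReal.ofReal t < 2 * u x}.indicator u with hw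
  have hle : ∀ x, u x ≤ w x + τ := by
    intro x
    by_cases hx : ENNReal.ofReal t < 2 * u x
    · have : w x = u x := indicator_of_mem (by exact hx) u
      rw [this]
      exact le_self_add
    · refine le_add_left ?_
      rw [not_lt, ← h2τ, ← two_mul] at hx
      exact (ENNReal.mul_le_mul_iff_right two_ne_zero ENNReal.ofNat_ne_top).1 hx
  have hmean : ∀ x, maximal u x ≤ maximal w x + τ := by
    intro x
    refine iSup₂_le fun s hs => ?_
    refine le_trans ?_ (add_le_add_left (ballMean_le_maximal w x hs) τ)
    unfold ballMean
    rw [ENNReal.div_le_iff (volume_closedBall_ne_zero x hs) (volume_closedBall_ne_top x s),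
      add_mul, ENNReal.div_mul_cancel (volume_closedBall_ne_zero x hs)
        (volume_closedBall_ne_top x s)]
    calc ∫⁻ z in closedBall x s, u z ≤ ∫⁻ z in closedBall x s, (w z + τ) :=
          lintegral_mono fun z => hle z
      _ = _ := by
          rw [lintegral_add_right _ measurable_const, setLIntegral_const]
  have hsub : {x | ENNReal.ofReal t < maximal u x} ⊆ {x | τ < maximal w x} := by
    intro x hx
    have h := lt_of_lt_of_le hx (hmean x)
    rw [← h2τ] at h
    exact (ENNReal.add_lt_add_iff_right ENNReal.ofReal_ne_top).1 h
  calc ENNReal.ofReal t * volume {x | ENNReal.ofReal t < maximal u x}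
      ≤ (2 * τ) * volume {x | τ < maximal w x} := by
        rw [two_mul, h2τ]
        gcongr
    _ = 2 * (τ * volume {x | τ < maximal w x}) := by ring
    _ ≤ 2 * (ENNReal.ofReal (4 ^ d) * ∫⁻ x, w x) := by
        gcongr 2 * ?_
        exact mul_volume_lt_maximal_le hd w τ
    _ = _ := by ring

/-- The strong type `(s, s)` estimate for the maximal function, `1 < s < ∞`. -/
theorem exists_lintegral_maximal_rpow_le (hd : 1 ≤ d) {s : ℝ} (hs : 1 < s) :
    ∃ C : ℝ≥0∞, C ≠ ∞ ∧ ∀ u : E d → ℝ≥0∞, AEMeasurable u volume →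
      ∫⁻ x, maximal u x ^ s ≤ C * ∫⁻ x, u x ^ s := by
  have hs1 : 0 < s - 1 := by linarith
  have hs0 : 0 < s := by linarith
  set C : ℝ≥0∞ := ENNReal.ofReal s * (2 * ENNReal.ofReal (4 ^ d)) *
    ((ENNReal.ofReal (s - 1))⁻¹ * 2 ^ (s - 1)) with hC
  have hCtop : C ≠ ∞ := by
    have h1 : (ENNReal.ofReal (s - 1))⁻¹ ≠ ∞ := by simpa using hs
    have h2 : (2 : ℝ≥0∞) ^ (s - 1) ≠ ∞ :=
      (ENNReal.rpow_lt_top_of_nonneg hs1.le ENNReal.ofNat_ne_top).ne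
    finiteness
  refine ⟨C, hCtop, ?_⟩
  have main : ∀ u : E d → ℝ≥0∞, Measurable u →
      ∫⁻ x, maximal u x ^ s ≤ C * ∫⁻ x, u x ^ s := by
    intro u hu
    have hMm := measurable_maximal u
    have hset1 : MeasurableSet {p : E d × ℝ | ENNReal.ofReal p.2 < maximal u p.1} :=
      measurableSet_lt (ENNReal.measurable_ofReal.comp measurable_snd) (hMm.comp measurable_fst)
    have hset2 : MeasurableSet {p : ℝ × E d | ENNReal.ofReal p.1 < 2 * u p.2} :=
      measurableSet_lt (ENNReal.measurable_ofReal.comp measurable_fst)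
        ((hu.comp measurable_snd).const_mul 2)
    have hm1 : Measurable (fun p : E d × ℝ =>
        {t : ℝ | ENNReal.ofReal t < maximal u p.1}.indicator
          (fun t => ENNReal.ofReal (t ^ (s - 1))) p.2) := by
      have h : Measurable (fun p : E d × ℝ => ENNReal.ofReal (p.2 ^ (s - 1))) := by fun_prop
      exact h.indicator hset1
    have hm2 : Measurable (fun p : ℝ × E d => ENNReal.ofReal (p.1 ^ (s - 1 - 1)) *
        {x | ENNReal.ofReal p.1 < 2 * u x}.indicator u p.2) := by
      have h : Measurable (fun p : ℝ × E d => ENNReal.ofReal (p.1 ^ (s - 1 - 1))) := by fun_prop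
      exact h.mul ((hu.comp measurable_snd).indicator hset2)
    calc ∫⁻ x, maximal u x ^ s
        ≤ ∫⁻ x, ENNReal.ofReal s * ∫⁻ t in Ioi (0 : ℝ),
            {t : ℝ | ENNReal.ofReal t < maximal u x}.indicator
              (fun t => ENNReal.ofReal (t ^ (s - 1))) t :=
          lintegral_mono fun x => rpow_le_lintegral_indicator_lt hs0 _
      _ = ENNReal.ofReal s * ∫⁻ t in Ioi (0 : ℝ), ∫⁻ x,
            {t : ℝ | ENNReal.ofReal t < maximal u x}.indicator
              (fun t => ENNReal.ofReal (t ^ (s - 1))) t := by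
          rw [lintegral_const_mul' _ _ ENNReal.ofReal_ne_top, lintegral_lintegral_swap]
          exact hm1.aemeasurable
      _ = ENNReal.ofReal s * ∫⁻ t in Ioi (0 : ℝ),
            ENNReal.ofReal (t ^ (s - 1)) * volume {x | ENNReal.ofReal t < maximal u x} := by
          congr 1
          refine lintegral_congr fun t => ?_
          have : (fun x => {t : ℝ | ENNReal.ofReal t < maximal u x}.indicator
              (fun t => ENNReal.ofReal (t ^ (s - 1))) t) =
              {x | ENNReal.ofReal t < maximal u x}.indicator
                (fun _ => ENNReal.ofReal (t ^ (s - 1))) := by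
            ext x
            simp [indicator]
          rw [this, lintegral_indicator (isOpen_lt_maximal u _).measurableSet,
            setLIntegral_const]
      _ ≤ ENNReal.ofReal s * ∫⁻ t in Ioi (0 : ℝ),
            (2 * ENNReal.ofReal (4 ^ d)) * ∫⁻ x, ENNReal.ofReal (t ^ (s - 1 - 1)) *
              {x | ENNReal.ofReal t < 2 * u x}.indicator u x := by
          gcongr ENNReal.ofReal s * ?_
          refine setLIntegral_mono' measurableSet_Ioi fun t ht => ?_
          have ht : 0 < t := ht
          -- One factor `t` is spent on the level-set bound. The remaining `t ^ (s - 2)` is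
          -- integrable near 0 since `s > 1`, and over `0 < t < 2u` yields a multiple of `u ^ (s -
          -- 1)`.
          rw [show t ^ (s - 1) = t ^ (s - 1 - 1) * t by
              rw [Real.rpow_sub_one ht.ne' (s - 1), div_mul_cancel₀ _ ht.ne'],
            ENNReal.ofReal_mul (by positivity), lintegral_const_mul' _ _ ENNReal.ofReal_ne_top,
            mul_assoc, mul_left_comm (2 * ENNReal.ofReal (4 ^ d))]
          gcongr ENNReal.ofReal (t ^ (s - 1 - 1)) * ?_
          exact volume_lt_maximal_le_lintegral_indicator hd u ht
      _ = ENNReal.ofReal s * ((2 * ENNReal.ofReal (4 ^ d)) *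
            ∫⁻ x, ∫⁻ t in Ioi (0 : ℝ), ENNReal.ofReal (t ^ (s - 1 - 1)) *
              {x | ENNReal.ofReal t < 2 * u x}.indicator u x) := by
          rw [lintegral_const_mul' _ _ (by finiteness), lintegral_lintegral_swap]
          exact hm2.aemeasurable
      _ ≤ ENNReal.ofReal s * ((2 * ENNReal.ofReal (4 ^ d)) *
            ∫⁻ x, ((ENNReal.ofReal (s - 1))⁻¹ * 2 ^ (s - 1)) * u x ^ s) := by
          gcongr with x
          have : ∀ t : ℝ, ENNReal.ofReal (t ^ (s - 1 - 1)) *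
              {x | ENNReal.ofReal t < 2 * u x}.indicator u x =
              u x * {t : ℝ | ENNReal.ofReal t < 2 * u x}.indicator
                (fun t => ENNReal.ofReal (t ^ (s - 1 - 1))) t := by
            intro t
            by_cases h : ENNReal.ofReal t < 2 * u x <;> simp [indicator, mul_comm]
          simp only [this]
          rw [lintegral_const_mul]
          swap
          · have h : Measurable (fun t : ℝ => ENNReal.ofReal (t ^ (s - 1 - 1))) := by fun_prop
            exact h.indicator (measurableSet_lt ENNReal.measurable_ofReal measurable_const)
          have h1 := lintegral_indicator_lt_le_rpow hs1 (2 * u x)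
          have h0 : ENNReal.ofReal (s - 1) ≠ 0 := by simpa using hs
          rw [ENNReal.mul_le_iff_le_inv h0 ENNReal.ofReal_ne_top] at h1
          calc _ ≤ u x * ((ENNReal.ofReal (s - 1))⁻¹ * (2 * u x) ^ (s - 1)) := by gcongr
            _ = ((ENNReal.ofReal (s - 1))⁻¹ * 2 ^ (s - 1)) * (u x ^ (1 : ℝ) * u x ^ (s - 1)) := by
                rw [ENNReal.mul_rpow_of_nonneg _ _ hs1.le, ENNReal.rpow_one]
                ring
            _ = _ := by
                rw [← ENNReal.rpow_add_of_nonneg _ _ zero_le_one hs1.le, add_sub_cancel]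
      _ = C * ∫⁻ x, u x ^ s := by
          rw [lintegral_const_mul _ (hu.pow_const s), hC]
          ring
  intro u hu
  have hae := hu.ae_eq_mk
  calc ∫⁻ x, maximal u x ^ s ≤ ∫⁻ x, maximal (hu.mk u) x ^ s := by
        gcongr with x
        exact maximal_mono_ae hae.le x
    _ ≤ C * ∫⁻ x, hu.mk u x ^ s := main _ hu.measurable_mk
    _ = C * ∫⁻ x, u x ^ s := by
        congr 1
        refine lintegral_congr_ae ?_
        filter_upwards [hae] with x hx
        rw [hx]

end MaximalFunction


/-! ### Variable powers and the modular -/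

section VarPow

variable {d : ℕ}

theorem varPow_top (t : ℝ≥0∞) : varPow t ∞ = if t ≤ 1 then 0 else ∞ := by simp [varPow]

theorem varPow_of_ne_top (t : ℝ≥0∞) {q : ℝ≥0∞} (hq : q ≠ ∞) : varPow t q = t ^ q.toReal := by
  simp [varPow, hq]

theorem varPow_mono {t u : ℝ≥0∞} (h : t ≤ u) (q : ℝ≥0∞) : varPow t q ≤ varPow u q := by
  rcases eq_or_ne q ∞ with rfl | hq
  · rw [varPow_top, varPow_top]
    split_ifs with h1 h2 h2
    · exact le_rfl
    · exact zero_le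
    · exact absurd (h.trans h2) h1
    · exact le_rfl
  · rw [varPow_of_ne_top _ hq, varPow_of_ne_top _ hq]
    gcongr

theorem aemeasurable_varPow {p u : E d → ℝ≥0∞} (hu : AEMeasurable u volume) (hp : Measurable p) :
    AEMeasurable (fun x => varPow (u x) (p x)) volume := by
  have h : Measurable (fun z : ℝ≥0∞ × ℝ≥0∞ => varPow z.1 z.2) := by
    unfold varPow
    refine Measurable.ite (measurable_snd (measurableSet_singleton ∞)) ?_ ?_
    · exact Measurable.ite (measurableSet_le measurable_fst measurable_const) measurable_const
        measurable_const
    · exact measurable_fst.pow measurable_snd.ennreal_toReal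
  exact h.comp_aemeasurable (hu.prodMk hp.aemeasurable)

/-- Using `q⁻¹` covers `q = ∞` uniformly: the exponent is then 0 and the hypothesis says `t ≤ 1`. -/
theorem varPow_le_of_le_rpow {t K q : ℝ≥0∞} (hq : 1 ≤ q) (h : t ≤ K ^ q⁻¹.toReal) :
    varPow t q ≤ K := by
  rcases eq_or_ne q ∞ with rfl | hqt
  · have : t ≤ 1 := by simpa using h
    simp [varPow_top, this]
  · have hq0 : q ≠ 0 := (one_pos.trans_le hq).ne'
    have hpos : 0 < q.toReal := ENNReal.toReal_pos hq0 hqt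
    rw [varPow_of_ne_top _ hqt]
    calc t ^ q.toReal ≤ (K ^ q⁻¹.toReal) ^ q.toReal := by gcongr
      _ = K := by
        rw [← ENNReal.rpow_mul, ENNReal.toReal_inv, inv_mul_cancel₀ hpos.ne', ENNReal.rpow_one]

/-- Convexity of the power, through `c ≤ c ^ q`. It turns a finite modular bound into a bound by 1
after division by a constant. -/
theorem varPow_div_le {t c q : ℝ≥0∞} (hq : 1 ≤ q) (hc : 1 ≤ c) (hct : c ≠ ∞) :
    varPow (t / c) q ≤ varPow t q / c := by
  have htc : t / c ≤ t := ENNReal.div_le_of_le_mul (le_mul_of_one_le_right' hc)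
  rcases eq_or_ne q ∞ with rfl | hqt
  · rw [varPow_top, varPow_top]
    split_ifs with h1 h2 h2
    · exact zero_le
    · exact zero_le
    · exact absurd (htc.trans h2) h1
    · rw [ENNReal.top_div_of_ne_top hct]
  · have h1 : 1 ≤ q.toReal := by
      rw [← ENNReal.toReal_one]
      exact ENNReal.toReal_mono hqt hq
    rw [varPow_of_ne_top _ hqt, varPow_of_ne_top _ hqt,
      ENNReal.div_rpow_of_nonneg _ _ (zero_le_one.trans h1)]
    gcongr
    calc c = c ^ (1 : ℝ) := (ENNReal.rpow_one c).symm
      _ ≤ c ^ q.toReal := ENNReal.rpow_le_rpow_of_exponent_le hc h1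

theorem modular_mono_ae (p : E d → ℝ≥0∞) {u v : E d → ℝ≥0∞} (h : u ≤ᵐ[volume] v) :
    modular p u ≤ modular p v :=
  lintegral_mono_ae (h.mono fun _ hx => varPow_mono hx _)

theorem modular_div_le {p : E d → ℝ≥0∞} (hp : ∀ᵐ x, 1 ≤ p x) (u : E d → ℝ≥0∞) {c : ℝ≥0∞}
    (hc : 1 ≤ c) (hct : c ≠ ∞) : modular p (fun x => u x / c) ≤ modular p u / c := by
  unfold modular
  simp only [div_eq_mul_inv (∫⁻ x, varPow (u x) (p x)) c]
  rw [← lintegral_mul_const' _ _ (by simpa using (one_pos.trans_le hc).ne')]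
  exact lintegral_mono_ae (hp.mono fun x hx => varPow_div_le hx hc hct)

end VarPow

/-! ### The maximal inequality for log-Hölder exponents -/

section MaximalInequality

open Metric Filter Topology

variable {d : ℕ}

/-- A weighted Young inequality for the modular, with the exponent `q / s ≥ 1`. -/
theorem le_rpow_add_varPow_mul_rpow {u S q : ℝ≥0∞} {s : ℝ} (hs : 0 < s) (hq : ENNReal.ofReal s ≤ q)
    (hS0 : S ≠ 0) (hSt : S ≠ ∞) :
    u ≤ S ^ (s * q⁻¹.toReal) + varPow u q ^ s⁻¹ * S ^ (s * q⁻¹.toReal - 1) := by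
  rcases eq_or_ne q ∞ with rfl | hqt
  · rw [varPow_top]
    split_ifs with h
    · simpa using le_add_right h
    · rw [ENNReal.top_rpow_of_pos (inv_pos.2 hs), ENNReal.top_mul, add_top]
      · exact le_top
      · exact (ENNReal.rpow_pos (pos_iff_ne_zero.2 hS0) hSt).ne'
  · rw [varPow_of_ne_top _ hqt]
    have hsQ : s ≤ q.toReal := (ENNReal.ofReal_le_iff_le_toReal hqt).1 hq
    set Q := q.toReal with hQ
    have hQ0 : 0 < Q := hs.trans_le hsQ
    have ha : s * q⁻¹.toReal = s / Q := by rw [ENNReal.toReal_inv, ← div_eq_mul_inv]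
    rw [ha]
    -- Either the first summand dominates, or `S ^ (s/Q) ≤ u` and the compensating power of `S` is
    -- bounded by `u ^ (Q/s - 1)`, with a nonnegative exponent because `s ≤ Q`.
    rcases le_total u (S ^ (s / Q)) with h | h
    · exact le_add_right h
    · refine le_add_left ?_
      have h1 : 0 ≤ Q / s - 1 := by
        rw [sub_nonneg, le_div_iff₀ hs]
        linarith
      calc u = u * (S ^ (1 - s / Q) * S ^ (s / Q - 1)) := by
            rw [← ENNReal.rpow_add _ _ hS0 hSt]
            simp
        _ = u * ((S ^ (s / Q)) ^ (Q / s - 1) * S ^ (s / Q - 1)) := by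
            rw [← ENNReal.rpow_mul, mul_sub, mul_one, div_mul_div_cancel₀ hQ0.ne', div_self hs.ne']
        _ ≤ u * (u ^ (Q / s - 1) * S ^ (s / Q - 1)) := by gcongr
        _ = (u ^ (1 : ℝ) * u ^ (Q / s - 1)) * S ^ (s / Q - 1) := by
            rw [ENNReal.rpow_one, mul_assoc]
        _ = (u ^ Q) ^ s⁻¹ * S ^ (s / Q - 1) := by
            rw [← ENNReal.rpow_add_of_nonneg _ _ zero_le_one h1, ← ENNReal.rpow_mul,
              add_sub_cancel, div_eq_mul_inv]

theorem LocallyLogHolder.const_mul {g : E d → ℝ} (hg : LocallyLogHolder g) {s : ℝ} (hs : 0 < s) :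
    LocallyLogHolder (fun x => s * g x) := by
  obtain ⟨C, hC, h⟩ := hg
  refine ⟨s * C, mul_pos hs hC, fun x y => ?_⟩
  rw [← mul_sub, abs_mul, abs_of_pos hs, mul_div_assoc]
  exact mul_le_mul_of_nonneg_left (h x y) hs.le

theorem LogHolderDecay.const_mul {g : E d → ℝ} (hg : LogHolderDecay g) {s : ℝ} (hs : 0 < s) :
    LogHolderDecay (fun x => s * g x) := by
  obtain ⟨c, C, hC, h⟩ := hg
  refine ⟨s * c, s * C, mul_pos hs hC, fun x => ?_⟩
  rw [← mul_sub, abs_mul, abs_of_pos hs, mul_div_assoc]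
  exact mul_le_mul_of_nonneg_left (h x) hs.le

theorem one_le_log_exp_one_add {t : ℝ} (ht : 0 ≤ t) : 1 ≤ Real.log (Real.exp 1 + t) := by
  rw [Real.le_log_iff_exp_le (by positivity)]
  linarith

theorem log_three_add_le {V r : ℝ} (hV : 0 < V) (hr : 0 < r) (d : ℕ) :
    Real.log (3 + 1 / (r ^ d * V)) ≤
      (Real.log (3 + 1 / V) + d) * Real.log (Real.exp 1 + 1 / r) := by
  set L := Real.log (Real.exp 1 + 1 / r) with hL
  have hL1 : 1 ≤ L := one_le_log_exp_one_add (by positivity)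
  have he : 1 ≤ Real.exp 1 + 1 / r := by
    have := Real.add_one_le_exp 1
    have : 0 < 1 / r := by positivity
    linarith
  have h1 : 3 + 1 / (r ^ d * V) ≤ (3 + 1 / V) * (Real.exp 1 + 1 / r) ^ d := by
    have h2 : 1 ≤ (Real.exp 1 + 1 / r) ^ d := one_le_pow₀ he
    have h3 : (1 / r) ^ d ≤ (Real.exp 1 + 1 / r) ^ d := by
      gcongr
      linarith [Real.exp_pos 1]
    have h4 : 1 / (r ^ d * V) = 1 / V * (1 / r) ^ d := by
      rw [one_div_pow]
      field_simp
    rw [h4, add_mul]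
    have h5 : 1 / V * (1 / r) ^ d ≤ 1 / V * (Real.exp 1 + 1 / r) ^ d := by gcongr
    linarith
  have hlog : 0 ≤ Real.log (3 + 1 / V) := by
    apply Real.log_nonneg
    have : 0 < 1 / V := by positivity
    linarith
  calc Real.log (3 + 1 / (r ^ d * V)) ≤ Real.log ((3 + 1 / V) * (Real.exp 1 + 1 / r) ^ d) :=
        Real.log_le_log (by positivity) h1
    _ = Real.log (3 + 1 / V) + d * L := by
        rw [Real.log_mul (by positivity) (by positivity), Real.log_pow]
    _ ≤ Real.log (3 + 1 / V) * L + d * L := by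
        gcongr
        exact le_mul_of_one_le_right hlog hL1
    _ = _ := by ring

/-- For a log-Hölder continuous exponent `a`, the powers `σ ^ a(x)` and `σ ^ a(y)` are comparable
when `σ` is not too large with respect to `|x - y|` and not too small with respect to `x`, `y`. -/
theorem exists_rpow_le_mul_rpow {a : E d → ℝ} (hl : LocallyLogHolder a) (hdec : LogHolderDecay a)
    {m V : ℝ} (hm : 0 < m) (hV : 0 < V) :
    ∃ C : ℝ, 0 < C ∧ ∀ (x y : E d) (r σ : ℝ), 0 < r → ‖x - y‖ ≤ r →
      (1 + ‖x‖) ^ (-m) ≤ σ → (1 + ‖y‖) ^ (-m) ≤ σ → σ ≤ 3 + 1 / (r ^ d * V) →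
      σ ^ a y ≤ C * σ ^ a x := by
  obtain ⟨C₂, hC₂, h₂⟩ := hl
  obtain ⟨c, C₁, hC₁, h₁⟩ := hdec
  set D := Real.log (3 + 1 / V) + d with hD
  have hD0 : 0 ≤ D := by
    have : 0 ≤ Real.log (3 + 1 / V) := by
      apply Real.log_nonneg
      have : 0 < 1 / V := by positivity
      linarith
    positivity
  refine ⟨Real.exp (2 * m * C₁ + D * C₂), Real.exp_pos _, ?_⟩
  intro x y r σ hr hxy hx hy hσ
  have hσ0 : 0 < σ := lt_of_lt_of_le (by positivity) hx
  rw [Real.rpow_def_of_pos hσ0, Real.rpow_def_of_pos hσ0, ← Real.exp_add, Real.exp_le_exp]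
  suffices h : Real.log σ * (a y - a x) ≤ 2 * m * C₁ + D * C₂ by linarith
  -- For `σ ≤ 1` the lower bounds give `-log σ ≤ m log(e + |z|)` at `z = x, y`, which the decay
  -- condition cancels. For `σ ≥ 1` the upper bound gives `log σ ≤ D log(e + 1/r)`, which the local
  -- condition cancels.
  rcases le_total σ 1 with h1 | h1
  · have hlogσ : Real.log σ ≤ 0 := Real.log_nonpos hσ0.le h1
    have key : ∀ z : E d, (1 + ‖z‖) ^ (-m) ≤ σ → -Real.log σ * |a z - c| ≤ m * C₁ := by
      intro z hz
      have hL : 1 ≤ Real.log (Real.exp 1 + ‖z‖) := one_le_log_exp_one_add (norm_nonneg z)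
      have h3 : -Real.log σ ≤ m * Real.log (Real.exp 1 + ‖z‖) := by
        have h4 := Real.log_le_log (by positivity) hz
        rw [Real.log_rpow (by positivity)] at h4
        have h5 : Real.log (1 + ‖z‖) ≤ Real.log (Real.exp 1 + ‖z‖) :=
          Real.log_le_log (by positivity) (by linarith [Real.add_one_le_exp 1])
        nlinarith
      calc -Real.log σ * |a z - c|
          ≤ (m * Real.log (Real.exp 1 + ‖z‖)) * (C₁ / Real.log (Real.exp 1 + ‖z‖)) := by
            gcongr
            exact h₁ z
        _ = m * C₁ := by field_simp
    have hx' := key x hx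
    have hy' := key y hy
    have htri : |a y - a x| ≤ |a y - c| + |a x - c| := by
      rw [abs_sub_comm (a x) c]
      exact abs_sub_le _ _ _
    have : Real.log σ * (a y - a x) ≤ -Real.log σ * |a y - a x| := by
      have := neg_abs_le (a y - a x)
      nlinarith
    have hDC : 0 ≤ D * C₂ := by positivity
    nlinarith
  · have hlogσ : 0 ≤ Real.log σ := Real.log_nonneg h1
    have hm0 : 0 ≤ 2 * m * C₁ := by positivity
    have hL : 1 ≤ Real.log (Real.exp 1 + 1 / r) := one_le_log_exp_one_add (by positivity)
    have h3 : Real.log σ ≤ D * Real.log (Real.exp 1 + 1 / r) :=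
      (Real.log_le_log hσ0 hσ).trans (log_three_add_le hV hr d)
    have h4 : |a y - a x| ≤ C₂ / Real.log (Real.exp 1 + 1 / r) := by
      rcases eq_or_ne x y with rfl | hne
      · rw [sub_self, abs_zero]
        positivity
      · rw [abs_sub_comm]
        refine (h₂ x y).trans ?_
        have hpos : 0 < ‖x - y‖ := norm_pos_iff.2 (sub_ne_zero.2 hne)
        gcongr
    calc Real.log σ * (a y - a x) ≤ Real.log σ * |a y - a x| := by
          gcongr
          exact le_abs_self _
      _ ≤ (D * Real.log (Real.exp 1 + 1 / r)) * (C₂ / Real.log (Real.exp 1 + 1 / r)) := by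
          gcongr
      _ = D * C₂ := by rw [mul_assoc, mul_div_cancel₀ _ (one_pos.trans_le hL).ne']
      _ ≤ _ := by linarith

/-- The integrable weight `(1 + |x|)^(-(d + 1))`. -/
noncomputable def decayWeight (x : E d) : ℝ≥0∞ := ENNReal.ofReal ((1 + ‖x‖) ^ (-((d : ℝ) + 1)))

theorem measurable_decayWeight : Measurable (decayWeight : E d → ℝ≥0∞) := by
  unfold decayWeight
  fun_prop

theorem decayWeight_le_one (x : E d) : decayWeight x ≤ 1 := by
  unfold decayWeight
  rw [ENNReal.ofReal_le_one]
  exact Real.rpow_le_one_of_one_le_of_nonpos (by linarith [norm_nonneg x]) (by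
    have : (0 : ℝ) ≤ d := d.cast_nonneg
    linarith)

theorem decayWeight_ne_zero (x : E d) : decayWeight x ≠ 0 := by
  unfold decayWeight
  rw [Ne, ENNReal.ofReal_eq_zero, not_le]
  positivity

theorem lintegral_decayWeight_rpow_lt_top {s : ℝ} (hs : 1 ≤ s) :
    ∫⁻ x : E d, decayWeight x ^ s < ∞ := by
  refine lt_of_le_of_lt (lintegral_mono fun x => ?_)
    (finite_integral_one_add_norm (E := E d) (μ := volume) (r := (d : ℝ) + 1) (by simp))
  calc decayWeight x ^ s ≤ decayWeight x ^ (1 : ℝ) :=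
        ENNReal.rpow_le_rpow_of_exponent_ge (decayWeight_le_one x) hs
    _ = _ := by rw [ENNReal.rpow_one]; rfl

theorem rpow_le_one_add_self {w : ℝ≥0∞} {a : ℝ} (ha0 : 0 ≤ a) (ha : a ≤ 1) :
    w ^ a ≤ 1 + w := by
  rcases le_total w 1 with h | h
  · exact le_add_right (ENNReal.rpow_le_one h ha0)
  · refine le_add_left ?_
    calc w ^ a ≤ w ^ (1 : ℝ) := ENNReal.rpow_le_rpow_of_exponent_le h ha
      _ = w := ENNReal.rpow_one w

/-- Average over the ball the weighted Young inequality for `u y`, whose parameter is essentially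
the mean of `v = u^{p/s}`. The powers produced carry the exponent `s / p y`; the comparison lemma
moves it to `s / p x`. -/
theorem exists_ballMean_le_mul_rpow {p : E d → ℝ≥0∞} (hp : IsLogHolderExponent p) {s : ℝ}
    (hs : 1 < s) (hsp : ∀ᵐ x, ENNReal.ofReal s ≤ p x) :
    ∃ C : ℝ≥0∞, C ≠ ∞ ∧ ∀ u : E d → ℝ≥0∞, modular p u ≤ 1 → ∀ x : E d,
      ENNReal.ofReal s ≤ p x → ∀ r : ℝ, 0 < r →
      ballMean u x r ≤ C *
        (ballMean (fun y => varPow (u y) (p y) ^ s⁻¹ + decayWeight y) x r + decayWeight x) ^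
          (s * (p x)⁻¹.toReal) := by
  have hs0 : 0 < s := one_pos.trans hs
  set V : ℝ := (volume (closedBall (0 : E d) 1)).toReal with hV
  have hV0 : 0 < V :=
    ENNReal.toReal_pos (volume_closedBall_ne_zero _ one_pos) (volume_closedBall_ne_top _ _)
  set a : E d → ℝ := fun x => s * (p x)⁻¹.toReal with ha
  obtain ⟨C, hC0, hC⟩ := exists_rpow_le_mul_rpow (a := a) (hp.locallyLogHolder.const_mul hs0)
    (hp.logHolderDecay.const_mul hs0) (m := (d : ℝ) + 1) (V := V) (by positivity) hV0
  refine ⟨3 * ENNReal.ofReal C, by finiteness, ?_⟩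
  intro u hu x hx r hr
  set v : E d → ℝ≥0∞ := fun y => varPow (u y) (p y) ^ s⁻¹ with hv
  set b := volume (closedBall x r) with hb
  have hb0 : b ≠ 0 := volume_closedBall_ne_zero x hr
  have hbt : b ≠ ∞ := volume_closedBall_ne_top x r
  have hbreal : b.toReal = r ^ d * V := by
    rw [hb, volume_closedBall_eq x hr.le, ENNReal.toReal_mul, ENNReal.toReal_ofReal (by positivity)]
  have hvle : ∀ y, v y ≤ 1 + varPow (u y) (p y) := fun y =>
    rpow_le_one_add_self (inv_nonneg.2 hs0.le) (inv_le_one_of_one_le₀ hs.le)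
  set T := ballMean v x r with hT
  have hTb : T * b = ∫⁻ y in closedBall x r, v y := ENNReal.div_mul_cancel hb0 hbt
  -- From `v ≤ 1 + u^p` and modular at most 1. This is the source of the upper bound `3 + 1/|B|`
  -- required of `σ` in the comparison lemma.
  have hTle : T ≤ 1 + b⁻¹ := by
    rw [hT, ballMean, ← hb, ENNReal.div_le_iff hb0 hbt, add_mul, one_mul,
      ENNReal.inv_mul_cancel hb0 hbt]
    calc ∫⁻ y in closedBall x r, v y ≤ ∫⁻ y in closedBall x r, (1 + varPow (u y) (p y)) :=
          lintegral_mono hvle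
      _ = b + ∫⁻ y in closedBall x r, varPow (u y) (p y) := by
          rw [lintegral_add_left measurable_const, setLIntegral_const, one_mul]
      _ ≤ b + 1 := by
          gcongr
          exact (setLIntegral_le_lintegral _ _).trans hu
  have hTt : T ≠ ∞ := ne_top_of_le_ne_top (by finiteness) hTle
  set T' := T + decayWeight x with hT'
  have hT'0 : T' ≠ 0 := by
    simp [hT', decayWeight_ne_zero]
  have hHt : ∀ y : E d, decayWeight y ≠ ∞ := fun y =>
    ne_top_of_le_ne_top ENNReal.one_ne_top (decayWeight_le_one y)
  have hT't : T' ≠ ∞ := ENNReal.add_ne_top.2 ⟨hTt, hHt x⟩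
  set K := ballMean (fun y => v y + decayWeight y) x r + decayWeight x with hK
  have hKT : K = T' + ballMean decayWeight x r := by
    rw [hK, ballMean, lintegral_add_right _ measurable_decayWeight, ENNReal.add_div, hT', hT]
    simp only [ballMean]
    ring
  have hHm : ballMean decayWeight x r ≤ 1 := by
    rw [ballMean, ENNReal.div_le_iff hb0 hbt]
    calc ∫⁻ y in closedBall x r, decayWeight y ≤ ∫⁻ y in closedBall x r, 1 :=
          lintegral_mono fun y => decayWeight_le_one y
      _ = 1 * b := by rw [setLIntegral_const]
  have hHb : ballMean decayWeight x r * b = ∫⁻ y in closedBall x r, decayWeight y :=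
    ENNReal.div_mul_cancel hb0 hbt
  have hT'K : T' ≤ K := by
    rw [hKT]
    exact le_self_add
  have hK0 : K ≠ 0 := (pos_iff_ne_zero.2 hT'0 |>.trans_le hT'K).ne'
  have hKt : K ≠ ∞ := by
    rw [hKT]
    exact ENNReal.add_ne_top.2 ⟨hT't, ne_top_of_le_ne_top ENNReal.one_ne_top hHm⟩
  have hax0 : 0 ≤ a x := mul_nonneg hs0.le ENNReal.toReal_nonneg
  have hax1 : a x ≤ 1 := by
    have h1 : (p x)⁻¹ ≤ (ENNReal.ofReal s)⁻¹ := ENNReal.inv_le_inv.2 hx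
    have h2 : (p x)⁻¹.toReal ≤ s⁻¹ := by
      rw [← ENNReal.ofReal_inv_of_pos hs0] at h1
      exact ENNReal.toReal_le_of_le_ofReal (inv_nonneg.2 hs0.le) h1
    calc a x ≤ s * s⁻¹ := mul_le_mul_of_nonneg_left h2 hs0.le
      _ = 1 := mul_inv_cancel₀ hs0.ne'
  have hpoint : ∀ᵐ y, y ∈ closedBall x r → u y ≤
      ENNReal.ofReal C * (K ^ a x * (1 + (T' + decayWeight y) / K)) +
        ENNReal.ofReal C * T' ^ (a x - 1) * v y := by
    filter_upwards [hsp] with y hy hyB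
    -- With both weights included, `S` satisfies the lower bounds at `x` and at `y` that the
    -- comparison lemma requires.
    set S := T' + decayWeight y with hS
    have hST' : T' ≤ S := le_self_add
    have hS0 : S ≠ 0 := (pos_iff_ne_zero.2 hT'0 |>.trans_le hST').ne'
    have hSt : S ≠ ∞ := ENNReal.add_ne_top.2 ⟨hT't, hHt y⟩
    have hσ0 : 0 < S.toReal := ENNReal.toReal_pos hS0 hSt
    have hcomp : S ^ a y ≤ ENNReal.ofReal C * S ^ a x := by
      have h1 := hC x y r S.toReal hr (by
          rw [mem_closedBall, dist_comm, dist_eq_norm] at hyB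
          exact hyB)
        ((ENNReal.ofReal_le_iff_le_toReal hSt).1 ((le_add_self : decayWeight x ≤ T').trans hST'))
        ((ENNReal.ofReal_le_iff_le_toReal hSt).1 (le_add_self : decayWeight y ≤ S)) (by
          have h2 : S ≤ 3 + b⁻¹ := by
            calc S ≤ (1 + b⁻¹) + 1 + 1 := by
                  rw [hS, hT']
                  gcongr
                  · exact decayWeight_le_one x
                  · exact decayWeight_le_one y
              _ = 3 + b⁻¹ := by ring
          have h3 := ENNReal.toReal_mono (by finiteness) h2
          rw [ENNReal.toReal_add (a := 3) (b := b⁻¹) (by finiteness) (by finiteness),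
            ENNReal.toReal_inv, hbreal] at h3
          simpa using h3)
      have h4 := ENNReal.ofReal_le_ofReal h1
      rwa [ENNReal.ofReal_mul hC0.le, ← ENNReal.ofReal_rpow_of_pos hσ0,
        ← ENNReal.ofReal_rpow_of_pos hσ0, ENNReal.ofReal_toReal hSt] at h4
    have hcomp' : S ^ (a y - 1) ≤ ENNReal.ofReal C * T' ^ (a x - 1) := by
      calc S ^ (a y - 1) = S ^ a y * S ^ (-1 : ℝ) := by
            rw [sub_eq_add_neg, ENNReal.rpow_add _ _ hS0 hSt]
        _ ≤ ENNReal.ofReal C * S ^ a x * S ^ (-1 : ℝ) := by gcongr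
        _ = ENNReal.ofReal C * S ^ (a x - 1) := by
            rw [sub_eq_add_neg, ENNReal.rpow_add _ _ hS0 hSt, mul_assoc]
        _ ≤ _ := by
            gcongr ENNReal.ofReal C * ?_
            rw [← neg_sub, ENNReal.rpow_neg, ENNReal.rpow_neg, ENNReal.inv_le_inv]
            exact ENNReal.rpow_le_rpow hST' (by linarith)
    have hyoung := le_rpow_add_varPow_mul_rpow (u := u y) hs0 hy hS0 hSt
    -- A substitute for Jensen: the bound is affine in `S`, and the mean of `S` over the ball is
    -- exactly `K`, so the bracket averages to 2.
    have hSK : S ^ a x ≤ K ^ a x * (1 + S / K) := by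
      calc S ^ a x = (K * (S / K)) ^ a x := by rw [ENNReal.mul_div_cancel hK0 hKt]
        _ = K ^ a x * (S / K) ^ a x := ENNReal.mul_rpow_of_nonneg _ _ hax0
        _ ≤ _ := by
            gcongr
            exact rpow_le_one_add_self hax0 hax1
    calc u y ≤ S ^ a y + v y * S ^ (a y - 1) := hyoung
      _ ≤ ENNReal.ofReal C * S ^ a x + v y * (ENNReal.ofReal C * T' ^ (a x - 1)) := by gcongr
      _ ≤ ENNReal.ofReal C * (K ^ a x * (1 + S / K)) +
          v y * (ENNReal.ofReal C * T' ^ (a x - 1)) := by gcongr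
      _ = _ := by ring
  have hcon : ENNReal.ofReal C * T' ^ (a x - 1) ≠ ∞ :=
    ENNReal.mul_ne_top ENNReal.ofReal_ne_top (ENNReal.rpow_ne_top_of_ne_zero hT'0 hT't)
  have hcon2 : K ^ a x ≠ ∞ := ENNReal.rpow_ne_top_of_ne_zero hK0 hKt
  have hint1 : ∫⁻ y in closedBall x r, (1 + (T' + decayWeight y) / K) = 2 * b := by
    have hS : ∫⁻ y in closedBall x r, (T' + decayWeight y) = K * b := by
      rw [lintegral_add_left measurable_const, setLIntegral_const, ← hHb, hKT, ← add_mul]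
    simp only [div_eq_mul_inv]
    rw [lintegral_add_left measurable_const, setLIntegral_const, one_mul,
      lintegral_mul_const' _ _ (by simpa using hK0), hS, mul_right_comm,
      ENNReal.mul_inv_cancel hK0 hKt, one_mul, ← hb, two_mul]
  have hT'pow : T' ^ (a x - 1) * T ≤ K ^ a x := by
    calc T' ^ (a x - 1) * T ≤ T' ^ (a x - 1) * T' ^ (1 : ℝ) := by
          rw [ENNReal.rpow_one]
          gcongr
          exact le_self_add
      _ = T' ^ a x := by rw [← ENNReal.rpow_add _ _ hT'0 hT't, sub_add_cancel]
      _ ≤ K ^ a x := by gcongr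
  rw [ballMean, ENNReal.div_le_iff hb0 hbt]
  calc ∫⁻ y in closedBall x r, u y
      ≤ ∫⁻ y in closedBall x r, (ENNReal.ofReal C * (K ^ a x * (1 + (T' + decayWeight y) / K)) +
        ENNReal.ofReal C * T' ^ (a x - 1) * v y) :=
        lintegral_mono_ae ((ae_restrict_iff' isClosed_closedBall.measurableSet).2 hpoint)
    _ = ENNReal.ofReal C * (K ^ a x * (2 * b)) + ENNReal.ofReal C * T' ^ (a x - 1) * (T * b) := by
        rw [lintegral_add_left, lintegral_const_mul' _ _ ENNReal.ofReal_ne_top,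
          lintegral_const_mul' _ _ hcon2, hint1, lintegral_const_mul' _ _ hcon, hTb]
        exact (((measurable_decayWeight.const_add T').div_const K).const_add 1
          |>.const_mul _).const_mul _
    _ = ENNReal.ofReal C * (2 * K ^ a x + T' ^ (a x - 1) * T) * b := by ring
    _ ≤ ENNReal.ofReal C * (2 * K ^ a x + K ^ a x) * b := by gcongr
    _ = 3 * ENNReal.ofReal C * K ^ a x * b := by ring

/-- The maximal operator maps the unit ball of `L^{p(·)}` into a multiple of itself. -/
theorem exists_modular_maximal_div_le_one (hd : 1 ≤ d) {p : E d → ℝ≥0∞}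
    (hp : IsLogHolderExponent p) (hp1 : 1 < essInf p volume) :
    ∃ A : ℝ, 0 < A ∧ ∀ u : E d → ℝ≥0∞, AEMeasurable u volume → modular p u ≤ 1 →
      modular p (fun x => maximal u x / ENNReal.ofReal A) ≤ 1 := by
  -- The minimum with 2 keeps `s` a real number greater than 1 even if the essential infimum is `∞`.
  set s : ℝ := (min (essInf p volume) 2).toReal with hs_def
  have hmin : min (essInf p volume) 2 ≠ ∞ := ne_top_of_le_ne_top ENNReal.ofNat_ne_top
    (min_le_right _ _)
  have hs : 1 < s := by
    rw [hs_def, ← ENNReal.toReal_one]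
    exact (ENNReal.toReal_lt_toReal ENNReal.one_ne_top hmin).2 (lt_min hp1 (by norm_num))
  have hs0 : 0 < s := one_pos.trans hs
  have hsp : ∀ᵐ x, ENNReal.ofReal s ≤ p x := by
    filter_upwards [ae_essInf_le (f := p) (μ := volume)] with x hx
    rw [hs_def, ENNReal.ofReal_toReal hmin]
    exact (min_le_left _ _).trans hx
  obtain ⟨C, hCt, hC⟩ := exists_ballMean_le_mul_rpow hp hs hsp
  obtain ⟨B, hBt, hB⟩ := exists_lintegral_maximal_rpow_le hd hs
  set I : ℝ≥0∞ := ∫⁻ x : E d, decayWeight x ^ s with hI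
  have hIt : I ≠ ∞ := (lintegral_decayWeight_rpow_lt_top hs.le).ne
  set c : ℝ≥0∞ := 2 ^ (s - 1) with hc
  have hct : c ≠ ∞ := (ENNReal.rpow_lt_top_of_nonneg (by linarith) ENNReal.ofNat_ne_top).ne
  set N : ℝ≥0∞ := c * (B * (c * (1 + I)) + I) with hN
  have hNt : N ≠ ∞ := by finiteness
  have hA : (C + 1) * (N + 1) ≠ ∞ := by finiteness
  have hA0 : (C + 1) * (N + 1) ≠ 0 := by simp
  -- `C + 1` absorbs the pointwise constant, leaving modular at most `N`; division by `N + 1 ≥ 1`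
  -- brings it below 1.
  refine ⟨((C + 1) * (N + 1)).toReal, ENNReal.toReal_pos hA0 hA, ?_⟩
  intro u hu hmod
  rw [ENNReal.ofReal_toReal hA]
  set v : E d → ℝ≥0∞ := fun y => varPow (u y) (p y) ^ s⁻¹ with hv
  set w : E d → ℝ≥0∞ := fun x => maximal (fun y => v y + decayWeight y) x + decayWeight x with hw
  have hvm : AEMeasurable v volume := (aemeasurable_varPow hu hp.isExponent.measurable).pow_const _
  have hpt : ∀ᵐ x, varPow (maximal u x / (C + 1)) (p x) ≤ w x ^ s := by
    filter_upwards [hsp] with x hx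
    refine varPow_le_of_le_rpow (hp.isExponent.one_le x) ?_
    rw [← ENNReal.rpow_mul]
    refine ENNReal.div_le_of_le_mul ?_
    rw [mul_comm]
    refine iSup₂_le fun r hr => (hC u hmod x hx r hr).trans ?_
    gcongr
    · exact le_self_add
    · exact add_le_add_left (ballMean_le_maximal _ x hr) _
  have hv1 : ∫⁻ x, v x ^ s ≤ 1 := by
    refine le_trans (le_of_eq ?_) hmod
    refine lintegral_congr fun x => ?_
    rw [hv, ← ENNReal.rpow_mul, inv_mul_cancel₀ hs0.ne', ENNReal.rpow_one]
  have hwN : ∫⁻ x, w x ^ s ≤ N := by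
    have hadd : ∀ f g : E d → ℝ≥0∞, AEMeasurable g volume →
        ∫⁻ x, (f x + g x) ^ s ≤ c * ((∫⁻ x, f x ^ s) + ∫⁻ x, g x ^ s) := by
      intro f g hg
      rw [← lintegral_add_right' _ (hg.pow_const s), ← lintegral_const_mul' _ _ hct]
      exact lintegral_mono fun x => ENNReal.rpow_add_le_mul_rpow_add_rpow _ _ hs.le
    calc ∫⁻ x, w x ^ s
        ≤ c * ((∫⁻ x, maximal (fun y => v y + decayWeight y) x ^ s) + I) :=
          hadd _ _ measurable_decayWeight.aemeasurable
      _ ≤ c * (B * (∫⁻ x, (v x + decayWeight x) ^ s) + I) := by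
          gcongr c * (?_ + I)
          exact hB _ (hvm.add measurable_decayWeight.aemeasurable)
      _ ≤ c * (B * (c * ((∫⁻ x, v x ^ s) + I)) + I) := by
          gcongr c * (B * ?_ + I)
          exact hadd _ _ measurable_decayWeight.aemeasurable
      _ ≤ N := by
          rw [hN]
          gcongr
  have hmod' : modular p (fun x => maximal u x / (C + 1)) ≤ N :=
    (lintegral_mono_ae hpt).trans hwN
  calc modular p (fun x => maximal u x / ((C + 1) * (N + 1)))
      = modular p (fun x => maximal u x / (C + 1) / (N + 1)) := by
        congr 1
        ext x
        rw [div_eq_mul_inv, div_eq_mul_inv, div_eq_mul_inv, ENNReal.mul_inv (by simp) (by simp),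
          mul_assoc]
    _ ≤ modular p (fun x => maximal u x / (C + 1)) / (N + 1) :=
        modular_div_le (ae_of_all _ hp.isExponent.one_le) _ le_add_self (by finiteness)
    _ ≤ 1 := by
        refine ENNReal.div_le_of_le_mul ?_
        rw [one_mul]
        exact hmod'.trans le_self_add

theorem exists_isMaximalConstant (hd : 1 ≤ d) {p : E d → ℝ≥0∞} (hp : IsLogHolderExponent p)
    (hp1 : 1 < essInf p volume) : ∃ A : ℝ, IsMaximalConstant p A := by
  obtain ⟨A, hA0, hA⟩ := exists_modular_maximal_div_le_one hd hp hp1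
  refine ⟨A, hA0, fun g hg => ?_⟩
  have hA' : ENNReal.ofReal A ≠ 0 := by simpa using hA0
  have hle : varNorm p (maximal fun z => ‖g z‖ₑ) / ENNReal.ofReal A ≤
      varNorm p (fun z => ‖g z‖ₑ) := by
    refine le_sInf fun l hl => ?_
    obtain ⟨hl0, hlt, hl1⟩ := hl
    refine ENNReal.div_le_of_le_mul ?_
    refine sInf_le ⟨ENNReal.mul_pos hl0.ne' hA', ENNReal.mul_ne_top hlt ENNReal.ofReal_ne_top, ?_⟩
    have h := hA (fun z => ‖g z‖ₑ / l) (hg.1.enorm.div_const l) hl1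
    refine le_of_eq_of_le ?_ h
    congr 1
    ext x
    have h1 : maximal (fun z => ‖g z‖ₑ / l) x = maximal (fun z => ‖g z‖ₑ) x / l := by
      have h2 := maximal_const_mul (u := fun z => ‖g z‖ₑ) (c := l⁻¹)
        (by simpa using hl0.ne') x
      simpa only [div_eq_mul_inv, mul_comm _ l⁻¹] using h2
    rw [h1, div_eq_mul_inv, div_eq_mul_inv, div_eq_mul_inv,
      ENNReal.mul_inv (Or.inl hl0.ne') (Or.inl hlt), mul_assoc]
  rwa [ENNReal.div_le_iff hA' ENNReal.ofReal_ne_top, mul_comm] at hle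

end MaximalInequality


/-! ### The pointwise estimate for weakly differentiable functions -/

section PointwiseEstimate

open Metric Filter Topology ContinuousLinearMap
open scoped Convolution

variable {d : ℕ}

theorem map_homothety_volume (x : E d) {t : ℝ} (ht : 0 < t) :
    Measure.map (fun z : E d => x + t • (z - x)) volume =
      ENNReal.ofReal ((t ^ d)⁻¹) • (volume : Measure (E d)) := by
  have h1 : (fun z : E d => x + t • (z - x)) =
      (fun z => x + z) ∘ (fun z => t • z) ∘ (fun z => z - x) := rfl
  rw [h1, ← Measure.map_map (by fun_prop) (by fun_prop), ← Measure.map_map (by fun_prop)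
    (by fun_prop), map_sub_right_eq_self, Measure.map_addHaar_smul _ ht.ne', Measure.map_smul,
    map_add_left_eq_self, finrank_euclideanSpace_fin, abs_of_nonneg (by positivity)]

theorem setLIntegral_closedBall_homothety {H : E d → ℝ≥0∞} (hH : Measurable H) (x : E d) {t R : ℝ}
    (ht : 0 < t) (hR : 0 < R) :
    ∫⁻ z in closedBall x R, H (x + t • (z - x)) =
      volume (closedBall x R) * ballMean H x (t * R) := by
  have hpre : (fun z : E d => x + t • (z - x)) ⁻¹' closedBall x (t * R) = closedBall x R := by
    ext z
    simp only [mem_preimage, mem_closedBall, dist_eq_norm, add_sub_cancel_left, norm_smul,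
      Real.norm_eq_abs, abs_of_pos ht]
    exact mul_le_mul_iff_right₀ ht
  have h := setLIntegral_map (μ := (volume : Measure (E d))) (s := closedBall x (t * R))
    isClosed_closedBall.measurableSet hH
    (show Measurable (fun z : E d => x + t • (z - x)) by fun_prop)
  rw [hpre, map_homothety_volume x ht, Measure.restrict_smul, lintegral_smul_measure] at h
  rw [← h, ballMean, volume_closedBall_mul x x ht.le hR.le, smul_eq_mul, div_eq_mul_inv,
    ENNReal.mul_inv (Or.inl (by simpa using pow_pos ht d)) (Or.inl ENNReal.ofReal_ne_top),
    ENNReal.ofReal_inv_of_pos (pow_pos ht d)]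
  calc _ = (ENNReal.ofReal (t ^ d))⁻¹ * (∫⁻ z in closedBall x (t * R), H z) *
        (volume (closedBall x R) * (volume (closedBall x R))⁻¹) := by
        rw [ENNReal.mul_inv_cancel (volume_closedBall_ne_zero x hR) (volume_closedBall_ne_top x R),
          mul_one]
    _ = _ := by ring

theorem enorm_sub_le_lintegral_fderiv {F : E d → ℝ} (hF : ContDiff ℝ 1 F) (x z : E d) :
    ‖F x - F z‖ₑ ≤ ‖z - x‖ₑ * ∫⁻ t in Ioc (0 : ℝ) 1, ‖fderiv ℝ F (x + t • (z - x))‖ₑ := by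
  have hderiv : ∀ t : ℝ, HasDerivAt (fun t : ℝ => F (x + t • (z - x)))
      (fderiv ℝ F (x + t • (z - x)) (z - x)) t := by
    intro t
    have h1 : HasDerivAt (fun t : ℝ => x + t • (z - x)) (z - x) t := by
      simpa using ((hasDerivAt_id t).smul_const (z - x)).const_add x
    exact ((hF.differentiable one_ne_zero) _).hasFDerivAt.comp_hasDerivAt t h1
  have hcont : Continuous (fun t : ℝ => fderiv ℝ F (x + t • (z - x)) (z - x)) :=
    ((hF.continuous_fderiv one_ne_zero).comp (by fun_prop)).clm_apply continuous_const
  have hint := intervalIntegral.integral_eq_sub_of_hasDerivAt (fun t _ => hderiv t)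
    (hcont.intervalIntegrable 0 1)
  simp only [one_smul, zero_smul, add_zero, add_sub_cancel] at hint
  rw [← enorm_neg, neg_sub, ← hint, intervalIntegral.integral_of_le zero_le_one,
    ← lintegral_const_mul' _ _ enorm_ne_top]
  refine (enorm_integral_le_lintegral_enorm _).trans (lintegral_mono fun t => ?_)
  rw [mul_comm]
  exact ContinuousLinearMap.le_opENorm _ _

/-- A Poincaré type inequality for smooth functions. -/
theorem lintegral_closedBall_enorm_sub_le {F : E d → ℝ} (hF : ContDiff ℝ 1 F) (x : E d) {R : ℝ}
    (hR : 0 < R) :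
    ∫⁻ z in closedBall x R, ‖F x - F z‖ₑ ≤
      ENNReal.ofReal R * (volume (closedBall x R) *
        restrictedMaximal R (fun z => ‖fderiv ℝ F z‖ₑ) x) := by
  have hcont : Continuous (fun z => ‖fderiv ℝ F z‖ₑ) :=
    (hF.continuous_fderiv one_ne_zero).enorm
  calc ∫⁻ z in closedBall x R, ‖F x - F z‖ₑ
      ≤ ∫⁻ z in closedBall x R, ENNReal.ofReal R *
          ∫⁻ t in Ioc (0 : ℝ) 1, ‖fderiv ℝ F (x + t • (z - x))‖ₑ := by
        refine setLIntegral_mono' isClosed_closedBall.measurableSet fun z hz => ?_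
        refine (enorm_sub_le_lintegral_fderiv hF x z).trans ?_
        gcongr
        rw [mem_closedBall, dist_eq_norm] at hz
        rw [← ofReal_norm]
        exact ENNReal.ofReal_le_ofReal hz
    -- After Tonelli, for fixed `t` the homothety about `x` turns the inner integral into a mean
    -- over `B(x; tR)`, and `tR ≤ R`.
    _ = ENNReal.ofReal R * ∫⁻ t in Ioc (0 : ℝ) 1, ∫⁻ z in closedBall x R,
          ‖fderiv ℝ F (x + t • (z - x))‖ₑ := by
        rw [lintegral_const_mul' _ _ ENNReal.ofReal_ne_top, lintegral_lintegral_swap]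
        refine Continuous.aemeasurable ?_
        exact hcont.comp (by fun_prop : Continuous fun p : E d × ℝ => x + p.2 • (p.1 - x))
    _ ≤ ENNReal.ofReal R * ∫⁻ t in Ioc (0 : ℝ) 1, volume (closedBall x R) *
          restrictedMaximal R (fun z => ‖fderiv ℝ F z‖ₑ) x := by
        gcongr ENNReal.ofReal R * ?_
        refine setLIntegral_mono' measurableSet_Ioc fun t ht => ?_
        rw [setLIntegral_closedBall_homothety hcont.measurable x ht.1 hR]
        gcongr
        exact ballMean_le_restrictedMaximal _ x (mul_pos ht.1 hR) (mul_le_of_le_one_left hR.le ht.2)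
    _ = _ := by simp

/-- The ball of radius `R/2` about the midpoint lies in both `B(x;R)` and `B(y;R)`. Averaging the
triangle inequality over it costs the volume ratio `2 ^ d`. -/
theorem enorm_sub_le_restrictedMaximal_fderiv {F : E d → ℝ} (hF : ContDiff ℝ 1 F) {x y : E d}
    (hxy : x ≠ y) :
    ‖F x - F y‖ₑ ≤ ENNReal.ofReal (2 ^ d * ‖x - y‖) *
      (restrictedMaximal ‖x - y‖ (fun z => ‖fderiv ℝ F z‖ₑ) x +
        restrictedMaximal ‖x - y‖ (fun z => ‖fderiv ℝ F z‖ₑ) y) := by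
  set R := ‖x - y‖ with hRdef
  have hR : 0 < R := norm_pos_iff.2 (sub_ne_zero.2 hxy)
  set c := midpoint ℝ x y with hc
  set b := volume (closedBall c (R / 2)) with hb
  have hb0 : b ≠ 0 := volume_closedBall_ne_zero c (by positivity)
  have hbt : b ≠ ∞ := volume_closedBall_ne_top c _
  have hvol : ∀ w : E d, volume (closedBall w R) = ENNReal.ofReal (2 ^ d) * b := by
    intro w
    rw [hb, ← volume_closedBall_mul w c (by norm_num) (by positivity), mul_div_cancel₀ R two_ne_zero]
  have hx : closedBall c (R / 2) ⊆ closedBall x R := by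
    refine closedBall_subset_closedBall' ?_
    rw [hc, dist_midpoint_left, dist_eq_norm, Real.norm_ofNat]
    linarith
  have hy : closedBall c (R / 2) ⊆ closedBall y R := by
    refine closedBall_subset_closedBall' ?_
    rw [hc, dist_midpoint_right, dist_eq_norm, Real.norm_ofNat]
    linarith
  have hFm : ∀ w : E d, Measurable (fun z => ‖F w - F z‖ₑ) := fun w =>
    ((continuous_const.sub hF.continuous).enorm).measurable
  have hmain : ‖F x - F y‖ₑ * b ≤ (ENNReal.ofReal (2 ^ d * R) *
      (restrictedMaximal R (fun z => ‖fderiv ℝ F z‖ₑ) x +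
        restrictedMaximal R (fun z => ‖fderiv ℝ F z‖ₑ) y)) * b := by
    calc ‖F x - F y‖ₑ * b = ∫⁻ z in closedBall c (R / 2), ‖F x - F y‖ₑ := by
          rw [setLIntegral_const]
      _ ≤ ∫⁻ z in closedBall c (R / 2), (‖F x - F z‖ₑ + ‖F y - F z‖ₑ) := by
          refine lintegral_mono fun z => ?_
          calc ‖F x - F y‖ₑ = ‖(F x - F z) - (F y - F z)‖ₑ := by rw [sub_sub_sub_cancel_right]
            _ ≤ _ := enorm_sub_le
      _ = (∫⁻ z in closedBall c (R / 2), ‖F x - F z‖ₑ) +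
            ∫⁻ z in closedBall c (R / 2), ‖F y - F z‖ₑ := lintegral_add_left (hFm x) _
      _ ≤ (∫⁻ z in closedBall x R, ‖F x - F z‖ₑ) + ∫⁻ z in closedBall y R, ‖F y - F z‖ₑ :=
          add_le_add (lintegral_mono_set hx) (lintegral_mono_set hy)
      _ ≤ _ := add_le_add (lintegral_closedBall_enorm_sub_le hF x hR)
          (lintegral_closedBall_enorm_sub_le hF y hR)
      _ = _ := by
          rw [hvol, hvol, ENNReal.ofReal_mul (by positivity)]
          ring
  exact (ENNReal.mul_le_mul_iff_left hb0 hbt).1 hmain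

/-! ### Mollification and the restricted maximal function -/

section Mollification

variable (φ : ContDiffBump (0 : E d))

/-- The convolution with a normed bump function, for functions with values in `[0, ∞]`. -/
noncomputable def bumpConvolution (H : E d → ℝ≥0∞) (z : E d) : ℝ≥0∞ :=
  ∫⁻ t, ‖φ.normed volume (z - t)‖ₑ * H t

theorem normed_sub_eq_zero_of_rOut_le {z t : E d} (h : φ.rOut ≤ dist z t) :
    φ.normed volume (z - t) = 0 := by
  have : z - t ∉ Function.support (φ.normed volume) := by
    rw [φ.support_normed_eq, mem_ball, dist_zero_right, ← dist_eq_norm, not_lt]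
    exact h
  exact Function.notMem_support.1 this

theorem lintegral_enorm_normed : ∫⁻ z : E d, ‖φ.normed volume z‖ₑ = 1 := by
  rw [← ENNReal.ofReal_one, ← φ.integral_normed (μ := volume),
    ofReal_integral_eq_lintegral_ofReal φ.integrable_normed
      (ae_of_all _ fun z => φ.nonneg_normed z)]
  refine lintegral_congr fun z => ?_
  rw [Real.enorm_eq_ofReal (φ.nonneg_normed z)]

/-- Scales above that of the kernel: by Tonelli and unit mass, nothing is gained, and only points
within `s + φ.rOut ≤ 2s` of `x` contribute. -/
theorem setLIntegral_bumpConvolution_le {H : E d → ℝ≥0∞} (hH : AEMeasurable H volume) (x : E d)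
    {s : ℝ} (hs : φ.rOut ≤ s) :
    ∫⁻ z in closedBall x s, bumpConvolution φ H z ≤ ∫⁻ t in closedBall x (2 * s), H t := by
  have hφ : Continuous (φ.normed volume) := φ.continuous_normed
  unfold bumpConvolution
  rw [lintegral_lintegral_swap]
  swap
  · refine AEMeasurable.mul ?_ hH.comp_snd
    exact Continuous.aemeasurable ((hφ.comp (continuous_fst.sub continuous_snd)).enorm)
  rw [← lintegral_indicator isClosed_closedBall.measurableSet]
  refine lintegral_mono fun t => ?_
  by_cases ht : t ∈ closedBall x (2 * s)
  · have hm : Measurable fun z : E d => ‖φ.normed volume (z - t)‖ₑ :=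
      (hφ.comp (continuous_id.sub continuous_const)).enorm.measurable
    rw [indicator_of_mem ht, lintegral_mul_const _ hm]
    calc (∫⁻ z in closedBall x s, ‖φ.normed volume (z - t)‖ₑ) * H t
        ≤ (∫⁻ z : E d, ‖φ.normed volume (z - t)‖ₑ) * H t := by
          gcongr
          exact Measure.restrict_le_self
      _ = H t := by
          rw [lintegral_sub_right_eq_self (fun z => ‖φ.normed volume z‖ₑ) t,
            lintegral_enorm_normed, one_mul]
  · rw [indicator_of_notMem ht, nonpos_iff_eq_zero]
    refine (setLIntegral_congr_fun isClosed_closedBall.measurableSet fun z hz => ?_).trans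
      lintegral_zero
    rw [mem_closedBall] at hz ht
    have h1 := dist_triangle t z x
    rw [dist_comm t z] at h1
    simp only
    rw [normed_sub_eq_zero_of_rOut_le φ (by linarith), enorm_zero, zero_mul]

/-- Scales below that of the kernel: it is at most `2 ^ d / |B(0; φ.rOut)|`, and passing to the ball
of twice the radius about `x` costs another `2 ^ d`. -/
theorem bumpConvolution_le_ballMean (hφ : φ.rOut ≤ 2 * φ.rIn) (H : E d → ℝ≥0∞) {x z : E d}
    (hz : dist z x ≤ φ.rOut) :
    bumpConvolution φ H z ≤ ENNReal.ofReal (4 ^ d) * ballMean H x (2 * φ.rOut) := by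
  set ε := φ.rOut with hε
  have hε0 : 0 < ε := φ.rOut_pos
  set b := volume (closedBall (0 : E d) ε) with hb
  have hb0 : b ≠ 0 := volume_closedBall_ne_zero _ hε0
  have hbt : b ≠ ∞ := volume_closedBall_ne_top _ _
  have hsup : ∀ w : E d, ‖φ.normed volume w‖ₑ ≤ ENNReal.ofReal (2 ^ d) * b⁻¹ := by
    intro w
    have h := φ.normed_le_div_measure_closedBall_rOut volume 2 hφ w
    rw [finrank_euclideanSpace_fin] at h
    rw [Real.enorm_eq_ofReal (φ.nonneg_normed w)]
    refine (ENNReal.ofReal_le_ofReal h).trans (le_of_eq ?_)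
    rw [div_eq_mul_inv, ENNReal.ofReal_mul (by positivity), measureReal_def,
      ENNReal.ofReal_inv_of_pos (ENNReal.toReal_pos hb0 hbt), ENNReal.ofReal_toReal hbt]
  calc bumpConvolution φ H z
      ≤ ∫⁻ t, (closedBall x (2 * ε)).indicator (fun t => ENNReal.ofReal (2 ^ d) * b⁻¹ * H t) t := by
        refine lintegral_mono fun t => ?_
        by_cases ht : t ∈ closedBall x (2 * ε)
        · rw [indicator_of_mem ht]
          gcongr
          exact hsup _
        · rw [mem_closedBall] at ht
          have h1 := dist_triangle t z x
          rw [dist_comm t z] at h1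
          rw [normed_sub_eq_zero_of_rOut_le φ (by linarith), enorm_zero, zero_mul]
          exact zero_le
    _ = ENNReal.ofReal (2 ^ d) * b⁻¹ * ∫⁻ t in closedBall x (2 * ε), H t := by
        rw [lintegral_indicator isClosed_closedBall.measurableSet, lintegral_const_mul' _ _
          (ENNReal.mul_ne_top ENNReal.ofReal_ne_top (by simpa using hb0))]
    _ = _ := by
        rw [ballMean, volume_closedBall_mul x 0 (by norm_num) hε0.le, ← hb,
          show (4 : ℝ) ^ d = 2 ^ d * 2 ^ d by rw [← mul_pow]; norm_num,
          ENNReal.ofReal_mul (by positivity), div_eq_mul_inv,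
          ENNReal.mul_inv (Or.inl (by simp)) (Or.inl ENNReal.ofReal_ne_top)]
        have h2 : ENNReal.ofReal (2 ^ d) * (ENNReal.ofReal (2 ^ d))⁻¹ = 1 :=
          ENNReal.mul_inv_cancel (by simp) ENNReal.ofReal_ne_top
        calc _ = ENNReal.ofReal (2 ^ d) * b⁻¹ * (∫⁻ t in closedBall x (2 * ε), H t) *
              (ENNReal.ofReal (2 ^ d) * (ENNReal.ofReal (2 ^ d))⁻¹) := by rw [h2, mul_one]
          _ = _ := by ring

theorem restrictedMaximal_bumpConvolution_le (hφ : φ.rOut ≤ 2 * φ.rIn) {H : E d → ℝ≥0∞}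
    (hH : AEMeasurable H volume) (x : E d) {R : ℝ} (hR : φ.rOut ≤ R) :
    restrictedMaximal R (bumpConvolution φ H) x ≤
      ENNReal.ofReal (4 ^ d) * restrictedMaximal (2 * R) H x := by
  refine iSup₂_le fun s hs => iSup_le fun hsR => ?_
  have hb0 := volume_closedBall_ne_zero x hs
  have hbt := volume_closedBall_ne_top x s
  rw [ballMean, ENNReal.div_le_iff hb0 hbt]
  rcases le_total φ.rOut s with h | h
  · calc ∫⁻ z in closedBall x s, bumpConvolution φ H z
        ≤ ∫⁻ t in closedBall x (2 * s), H t := setLIntegral_bumpConvolution_le φ hH x h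
      _ = ballMean H x (2 * s) * volume (closedBall x (2 * s)) :=
          (ENNReal.div_mul_cancel (volume_closedBall_ne_zero x (by positivity))
            (volume_closedBall_ne_top x _)).symm
      _ ≤ restrictedMaximal (2 * R) H x * (ENNReal.ofReal (4 ^ d) * volume (closedBall x s)) := by
          rw [volume_closedBall_mul x x (by norm_num) hs.le]
          gcongr
          · exact ballMean_le_restrictedMaximal H x (by positivity) (by linarith)
          · norm_num
      _ = _ := by ring
  · calc ∫⁻ z in closedBall x s, bumpConvolution φ H z
        ≤ ∫⁻ z in closedBall x s, ENNReal.ofReal (4 ^ d) * restrictedMaximal (2 * R) H x := by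
          refine setLIntegral_mono' isClosed_closedBall.measurableSet fun z hz => ?_
          refine (bumpConvolution_le_ballMean φ hφ H (hz.trans h)).trans ?_
          gcongr
          exact ballMean_le_restrictedMaximal H x (by linarith [φ.rOut_pos]) (by linarith)
      _ = _ := by rw [setLIntegral_const]

theorem contDiff_normed_convolution {f : E d → ℝ} (hf : LocallyIntegrable f volume) :
    ContDiff ℝ 1 (φ.normed volume ⋆[lsmul ℝ ℝ, volume] f) :=
  φ.hasCompactSupport_normed.contDiff_convolution_left (n := 1) _ φ.contDiff_normed hf

/-- The derivative falls on the kernel. As a test function, `t ↦ φ(x - t)` has derivative with a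
minus sign, cancelling the one in the definition of the weak gradient. -/
theorem HasWeakGradient.fderiv_normed_convolution {f : E d → ℝ} {G : E d → E d}
    (h : HasWeakGradient f G) (x : E d) :
    fderiv ℝ (φ.normed volume ⋆[lsmul ℝ ℝ, volume] f) x =
      innerSL ℝ (∫ t, φ.normed volume (x - t) • G t) := by
  set ψ : E d → ℝ := fun t => φ.normed volume (x - t) with hψ
  have hφs : ContDiff ℝ (⊤ : ℕ∞) (φ.normed volume : E d → ℝ) := φ.contDiff_normed
  have hψs : ContDiff ℝ (⊤ : ℕ∞) ψ := hφs.comp (contDiff_const.sub contDiff_id)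
  have hψc : HasCompactSupport ψ :=
    φ.hasCompactSupport_normed.comp_homeomorph (Homeomorph.subLeft x)
  have hder := φ.hasCompactSupport_normed.hasFDerivAt_convolution_right
    (lsmul ℝ ℝ : ℝ →L[ℝ] ℝ →L[ℝ] ℝ).flip h.locallyIntegrable
    (hφs.of_le (by exact_mod_cast le_top)) x (μ := (volume : Measure (E d)))
  rw [convolution_flip] at hder
  rw [hder.fderiv]
  have hint : Integrable (fun t => φ.normed volume (x - t) • G t) :=
    h.locallyIntegrable_grad.integrable_smul_left_of_hasCompactSupport hψs.continuous hψc
  have hψd : ∀ (t e : E d), fderiv ℝ ψ t e = -(fderiv ℝ (φ.normed volume) (x - t) e) := by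
    intro t e
    have h1 : HasFDerivAt (fun t : E d => x - t) (-(ContinuousLinearMap.id ℝ (E d))) t := by
      simpa using (hasFDerivAt_id t).const_sub x
    have h2 := ((hφs.differentiable (by simp)) (x - t)).hasFDerivAt.comp t h1
    have h3 : fderiv ℝ ψ t = (fderiv ℝ (φ.normed volume) (x - t)).comp
      (-(ContinuousLinearMap.id ℝ (E d))) := h2.fderiv
    rw [h3]
    simp
  have hcoord : ∀ i : Fin d,
      (f ⋆[(lsmul ℝ ℝ : ℝ →L[ℝ] ℝ →L[ℝ] ℝ).flip.precompR (E d), volume]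
        fderiv ℝ (φ.normed volume)) x (EuclideanSpace.single i 1) =
      (∫ t, φ.normed volume (x - t) • G t) i := by
    intro i
    rw [convolution_precompR_apply _ h.locallyIntegrable (φ.hasCompactSupport_normed.fderiv ℝ)
      (hφs.continuous_fderiv (by simp)), convolution_def]
    have h1 := h.integral_eq ψ hψs hψc i
    have h2 : (∫ t, φ.normed volume (x - t) • G t) i = ∫ t, (φ.normed volume (x - t) • G t) i :=
      ((EuclideanSpace.proj i : E d →L[ℝ] ℝ).integral_comp_comm hint).symm
    rw [h2]
    calc _ = -∫ t, f t * fderiv ℝ ψ t (EuclideanSpace.single i 1) := by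
          rw [← integral_neg]
          refine integral_congr_ae (ae_of_all _ fun t => ?_)
          simp [hψd, mul_comm]
      _ = _ := by
          rw [h1, neg_neg]
          refine integral_congr_ae (ae_of_all _ fun t => ?_)
          simp [hψ, mul_comm]
  refine ContinuousLinearMap.coe_injective ?_
  refine (EuclideanSpace.basisFun (Fin d) ℝ).toBasis.ext fun i => ?_
  simpa [EuclideanSpace.inner_single_right] using hcoord i

theorem HasWeakGradient.enorm_fderiv_normed_convolution_le {f : E d → ℝ} {G : E d → E d}
    (h : HasWeakGradient f G) (x : E d) :
    ‖fderiv ℝ (φ.normed volume ⋆[lsmul ℝ ℝ, volume] f) x‖ₑ ≤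
      bumpConvolution φ (fun z => ‖G z‖ₑ) x := by
  rw [h.fderiv_normed_convolution, ← ofReal_norm, innerSL_apply_norm,
    ofReal_norm]
  refine (enorm_integral_le_lintegral_enorm _).trans (le_of_eq ?_)
  simp only [bumpConvolution, enorm_smul]

end Mollification

/-- The constant is `2 ^ d` from the smooth estimate times `4 ^ d` from mollification. The latter
also doubles the radius, whence `2|x - y|`. -/
theorem HasWeakGradient.isPointwiseConstant {f : E d → ℝ} {G : E d → E d}
    (h : HasWeakGradient f G) : IsPointwiseConstant f G (8 ^ d) := by
  refine ⟨by positivity, ?_⟩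
  -- A fixed ratio 2 of outer to inner radius keeps the kernel bounds uniform and ensures almost
  -- everywhere convergence.
  let φ : ℕ → ContDiffBump (0 : E d) := fun n =>
    ⟨((n : ℝ) + 1)⁻¹, 2 * ((n : ℝ) + 1)⁻¹, by positivity, by
      have : 0 < ((n : ℝ) + 1)⁻¹ := by positivity
      linarith⟩
  have hφ : ∀ n, (φ n).rOut ≤ 2 * (φ n).rIn := fun n => le_rfl
  have hlim : Tendsto (fun n => (φ n).rOut) atTop (𝓝 0) := by
    have := (tendsto_one_div_add_atTop_nhds_zero_nat (𝕜 := ℝ)).const_mul 2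
    simpa [φ] using this
  have hae := ContDiffBump.ae_convolution_tendsto_right_of_locallyIntegrable (μ := volume) hlim
    (Eventually.of_forall hφ) h.locallyIntegrable
  set S : Set (E d) := {x | ¬ Tendsto (fun n =>
    ((φ n).normed volume ⋆[lsmul ℝ ℝ, volume] f) x) atTop (𝓝 (f x))} with hS
  have hS0 : volume S = 0 := hae
  refine ⟨toMeasurable volume S, measurableSet_toMeasurable _ _, by rw [measure_toMeasurable, hS0],
    fun x hx y hy => ?_⟩
  have hx' : Tendsto (fun n => ((φ n).normed volume ⋆[lsmul ℝ ℝ, volume] f) x) atTop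
      (𝓝 (f x)) := by
    by_contra hc
    exact hx (subset_toMeasurable _ _ hc)
  have hy' : Tendsto (fun n => ((φ n).normed volume ⋆[lsmul ℝ ℝ, volume] f) y) atTop
      (𝓝 (f y)) := by
    by_contra hc
    exact hy (subset_toMeasurable _ _ hc)
  rcases eq_or_ne x y with rfl | hxy
  · simp
  have hR : 0 < ‖x - y‖ := norm_pos_iff.2 (sub_ne_zero.2 hxy)
  have hGm : AEMeasurable (fun z => ‖G z‖ₑ) volume :=
    h.locallyIntegrable_grad.aestronglyMeasurable.enorm
  rw [← Real.enorm_eq_ofReal_abs]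
  refine le_of_tendsto (hx'.sub hy').enorm ?_
  filter_upwards [hlim.eventually (gt_mem_nhds hR)] with n hn
  have hmono : ∀ w : E d, restrictedMaximal ‖x - y‖
      (fun z => ‖fderiv ℝ ((φ n).normed volume ⋆[lsmul ℝ ℝ, volume] f) z‖ₑ) w ≤
      ENNReal.ofReal (4 ^ d) * restrictedMaximal (2 * ‖x - y‖) (fun z => ‖G z‖ₑ) w := by
    intro w
    refine le_trans ?_ (restrictedMaximal_bumpConvolution_le (φ n) (hφ n) hGm w hn.le)
    refine iSup₂_mono fun s _ => iSup_mono fun _ => ballMean_mono_ae (ae_of_all _ fun z => ?_) w s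
    exact h.enorm_fderiv_normed_convolution_le (φ n) z
  calc _ ≤ _ := enorm_sub_le_restrictedMaximal_fderiv
        (contDiff_normed_convolution (φ n) h.locallyIntegrable) hxy
    _ ≤ ENNReal.ofReal (2 ^ d * ‖x - y‖) *
        (ENNReal.ofReal (4 ^ d) * restrictedMaximal (2 * ‖x - y‖) (fun z => ‖G z‖ₑ) x +
          ENNReal.ofReal (4 ^ d) * restrictedMaximal (2 * ‖x - y‖) (fun z => ‖G z‖ₑ) y) := by
        gcongr
        · exact hmono x
        · exact hmono y
    _ = _ := by
        rw [show (8 : ℝ) ^ d * ‖x - y‖ = 2 ^ d * ‖x - y‖ * 4 ^ d by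
            rw [mul_right_comm, ← mul_pow]; norm_num,
          ENNReal.ofReal_mul (p := 2 ^ d * ‖x - y‖) (by positivity)]
        ring

end PointwiseEstimate


variable {d : ℕ}

/-! ### Hölder's inequality in variable exponents and the norm of the gradient -/

section Holder

theorem modular_congr_ae (p : E d → ℝ≥0∞) {u v : E d → ℝ≥0∞} (h : u =ᵐ[volume] v) :
    modular p u = modular p v :=
  le_antisymm (modular_mono_ae p h.le) (modular_mono_ae p h.symm.le)

theorem one_le_dualExponent (p : E d → ℝ≥0∞) (x : E d) : 1 ≤ dualExponent p x :=
  le_self_add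

theorem mul_le_varPow_add_varPow {q : ℝ≥0∞} (hq : 1 < q) (a b : ℝ≥0∞) :
    a * b ≤ varPow a q + varPow b (ENNReal.conjExponent q) := by
  rcases eq_or_ne q ∞ with rfl | hqt
  · rw [varPow_top]
    split_ifs with h
    · have h1 : ENNReal.conjExponent ∞ = 1 := by simp [ENNReal.conjExponent]
      rw [h1, varPow_of_ne_top _ ENNReal.one_ne_top, zero_add, ENNReal.toReal_one,
        ENNReal.rpow_one]
      exact mul_le_of_le_one_left' h
    · simp
  · have hQ : 1 < q.toReal := by
      rw [← ENNReal.toReal_one]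
      exact (ENNReal.toReal_lt_toReal ENNReal.one_ne_top hqt).2 hq
    have h0 : q - 1 ≠ 0 := (tsub_pos_of_lt hq).ne'
    have hct : ENNReal.conjExponent q ≠ ∞ := by
      unfold ENNReal.conjExponent
      finiteness
    have hc : (ENNReal.conjExponent q).toReal = Real.conjExponent q.toReal := by
      rw [ENNReal.conjExponent, ENNReal.toReal_add ENNReal.one_ne_top (by finiteness),
        ENNReal.toReal_inv, ENNReal.toReal_sub_of_le hq.le hqt, ENNReal.toReal_one,
        Real.conjExponent]
      have : q.toReal - 1 ≠ 0 := by linarith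
      field_simp
      ring
    rw [varPow_of_ne_top _ hqt, varPow_of_ne_top _ hct, hc]
    have hconj : q.toReal.HolderConjugate (Real.conjExponent q.toReal) := .conjExponent hQ
    refine (ENNReal.young_inequality a b hconj).trans (add_le_add ?_ ?_)
    · refine ENNReal.div_le_of_le_mul (le_mul_of_one_le_right' ?_)
      exact ENNReal.one_le_ofReal.2 hQ.le
    · refine ENNReal.div_le_of_le_mul (le_mul_of_one_le_right' ?_)
      exact ENNReal.one_le_ofReal.2 hconj.symm.lt.le

/-- Young's inequality for the normalised functions bounds their pairing by the sum of two modulars,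
hence the factor 2. The infima over the two normalisations are taken one after the other. -/
theorem lintegral_mul_le_two_mul_varNorm {p u w : E d → ℝ≥0∞} (hp : ∀ᵐ x, 1 < p x)
    (hpm : Measurable p) (hu : AEMeasurable u volume)
    (hut : varNorm p u ≠ ∞) (hwt : varNorm (dualExponent p) w ≠ ∞) :
    ∫⁻ x, u x * w x ≤ 2 * varNorm p u * varNorm (dualExponent p) w := by
  have key : ∀ l₁ l₂ : ℝ≥0∞, 0 < l₁ → l₁ ≠ ∞ → modular p (fun x => u x / l₁) ≤ 1 →
      0 < l₂ → l₂ ≠ ∞ → modular (dualExponent p) (fun x => w x / l₂) ≤ 1 →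
      ∫⁻ x, u x * w x ≤ 2 * l₁ * l₂ := by
    intro l₁ l₂ h1 h1t hm1 h2 h2t hm2
    calc ∫⁻ x, u x * w x = ∫⁻ x, (l₁ * l₂) * ((u x / l₁) * (w x / l₂)) := by
          refine lintegral_congr fun x => ?_
          calc u x * w x = (l₁ * (u x / l₁)) * (l₂ * (w x / l₂)) := by
                rw [ENNReal.mul_div_cancel h1.ne' h1t, ENNReal.mul_div_cancel h2.ne' h2t]
            _ = _ := by ring
      _ = (l₁ * l₂) * ∫⁻ x, (u x / l₁) * (w x / l₂) :=
          lintegral_const_mul' _ _ (ENNReal.mul_ne_top h1t h2t)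
      _ ≤ (l₁ * l₂) * ∫⁻ x, (varPow (u x / l₁) (p x) + varPow (w x / l₂) (dualExponent p x)) := by
          gcongr (l₁ * l₂) * ?_
          exact lintegral_mono_ae (hp.mono fun x hx => mul_le_varPow_add_varPow hx _ _)
      _ = (l₁ * l₂) * (modular p (fun x => u x / l₁) +
            modular (dualExponent p) (fun x => w x / l₂)) := by
          rw [lintegral_add_left' (aemeasurable_varPow (hu.div_const l₁) hpm)]
          rfl
      _ ≤ (l₁ * l₂) * (1 + 1) := by gcongr
      _ = _ := by rw [one_add_one_eq_two]; ring
  set I := ∫⁻ x, u x * w x with hI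
  have key2 : ∀ l₂ : ℝ≥0∞, 0 < l₂ → l₂ ≠ ∞ →
      modular (dualExponent p) (fun x => w x / l₂) ≤ 1 → I ≤ 2 * varNorm p u * l₂ := by
    intro l₂ h2 h2t hm2
    have h : I / (2 * l₂) ≤ varNorm p u := by
      refine le_sInf fun l₁ hl₁ => ?_
      rw [ENNReal.div_le_iff (mul_ne_zero two_ne_zero h2.ne') (by finiteness)]
      refine (key l₁ l₂ hl₁.1 hl₁.2.1 hl₁.2.2 h2 h2t hm2).trans (le_of_eq ?_)
      ring
    rw [ENNReal.div_le_iff (mul_ne_zero two_ne_zero h2.ne') (by finiteness)] at h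
    exact h.trans (le_of_eq (by ring))
  -- Division by a zero norm is impossible; then one admissible finite `l₂`, which exists as the
  -- other norm is finite, already forces the integral to vanish.
  rcases eq_or_ne (varNorm p u) 0 with h0 | h0
  · obtain ⟨l₂, hl₂⟩ : {l : ℝ≥0∞ | 0 < l ∧ l ≠ ∞ ∧
        modular (dualExponent p) (fun x => w x / l) ≤ 1}.Nonempty := by
      by_contra hne
      rw [not_nonempty_iff_eq_empty] at hne
      exact hwt (by rw [varNorm, hne, sInf_empty])
    have h := key2 l₂ hl₂.1 hl₂.2.1 hl₂.2.2
    rw [h0] at h ⊢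
    simpa using h
  · have hne : 2 * varNorm p u ≠ 0 := mul_ne_zero two_ne_zero h0
    have hnt : 2 * varNorm p u ≠ ∞ := by finiteness
    have h : I / (2 * varNorm p u) ≤ varNorm (dualExponent p) w := by
      refine le_sInf fun l₂ hl₂ => ?_
      rw [ENNReal.div_le_iff hne hnt]
      exact (key2 l₂ hl₂.1 hl₂.2.1 hl₂.2.2).trans (le_of_eq (mul_comm _ _))
    rw [ENNReal.div_le_iff hne hnt] at h
    exact h.trans (le_of_eq (mul_comm _ _))

theorem MemVarLp.varNorm_ne_top {p : E d → ℝ≥0∞} (hp : ∀ x, 1 ≤ p x) {f : E d → ℝ}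
    (hf : MemVarLp p f) : varNorm p (fun x => ‖f x‖ₑ) ≠ ∞ := by
  obtain ⟨-, a, ha, hmod⟩ := hf
  set c := modular p (fun x => ENNReal.ofReal a * ‖f x‖ₑ) + 1 with hc
  have hct : c ≠ ∞ := ENNReal.add_ne_top.2 ⟨hmod.ne, ENNReal.one_ne_top⟩
  have hc1 : 1 ≤ c := le_add_self
  have hc0 : c ≠ 0 := (one_pos.trans_le hc1).ne'
  have ha0 : ENNReal.ofReal a ≠ 0 := by simpa using ha
  have hlt : c / ENNReal.ofReal a ≠ ∞ := ENNReal.div_ne_top hct ha0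
  refine ne_top_of_le_ne_top hlt (sInf_le ⟨ENNReal.div_pos hc0 ENNReal.ofReal_ne_top, hlt, ?_⟩)
  have heq : (fun x => ‖f x‖ₑ / (c / ENNReal.ofReal a)) =
      fun x => ENNReal.ofReal a * ‖f x‖ₑ / c := by
    ext x
    rw [div_eq_mul_inv, ENNReal.inv_div (Or.inl ENNReal.ofReal_ne_top) (Or.inl ha0),
      div_eq_mul_inv, div_eq_mul_inv]
    ring
  rw [heq]
  refine (modular_div_le (ae_of_all _ hp) _ hc1 hct).trans ?_
  refine ENNReal.div_le_of_le_mul ?_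
  rw [one_mul]
  exact le_self_add

/-- Testing against all smooth compactly supported functions determines the gradient. Thus
integrability of the gradient provided by `MemSobolev` passes to any other representative. -/
theorem HasWeakGradient.ae_eq {f : E d → ℝ} {G G' : E d → E d} (h : HasWeakGradient f G)
    (h' : HasWeakGradient f G') : G =ᵐ[volume] G' := by
  refine ae_eq_of_integral_contDiff_smul_eq h.locallyIntegrable_grad h'.locallyIntegrable_grad
    fun φ hφ hc => ?_
  have hcoord : ∀ {H : E d → E d}, HasWeakGradient f H → ∀ i : Fin d,
      (∫ x, φ x • H x) i = -∫ x, f x * fderiv ℝ φ x (EuclideanSpace.single i 1) := by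
    intro H hH i
    have hint : Integrable (fun t => φ t • H t) :=
      hH.locallyIntegrable_grad.integrable_smul_left_of_hasCompactSupport hφ.continuous hc
    have h2 : (∫ t, φ t • H t) i = ∫ t, (φ t • H t) i :=
      ((EuclideanSpace.proj i : E d →L[ℝ] ℝ).integral_comp_comm hint).symm
    rw [h2, hH.integral_eq φ hφ hc i, neg_neg]
    refine integral_congr_ae (ae_of_all _ fun t => ?_)
    simp [mul_comm]
  ext i
  rw [hcoord h i, hcoord h' i]

theorem MemSobolev.memVarLp_norm {p : E d → ℝ≥0∞} {f : E d → ℝ} {G : E d → E d}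
    (hf : MemSobolev p f) (hG : HasWeakGradient f G) : MemVarLp p (fun x => ‖G x‖) := by
  obtain ⟨-, G', hG', -, a, ha, hmod⟩ := hf
  refine ⟨hG.locallyIntegrable_grad.aestronglyMeasurable.norm.aemeasurable, a, ha, ?_⟩
  refine lt_of_eq_of_lt (modular_congr_ae p ?_) hmod
  filter_upwards [hG.ae_eq hG'] with x hx
  rw [hx]

end Holder

/-! ### Random variables with densities and the final estimate -/

section Density

variable {Ω : Type*} [MeasurableSpace Ω] {P : Measure Ω} {X X' : Ω → E d} {g g' : E d → ℝ}

theorem HasDensity.absolutelyContinuous (h : HasDensity P X g) : Measure.map X P ≪ volume := by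
  rw [h.map_eq]
  exact withDensity_absolutelyContinuous _ _

theorem HasDensity.ae_comp (h : HasDensity P X g) {q : E d → Prop} (hq : ∀ᵐ x, q x) :
    ∀ᵐ ω ∂P, q (X ω) :=
  ae_of_ae_map h.measurable.aemeasurable (h.absolutelyContinuous.ae_le hq)

theorem HasDensity.aemeasurable_comp {β : Type*} [MeasurableSpace β] (h : HasDensity P X g)
    {u : E d → β} (hu : AEMeasurable u volume) : AEMeasurable (fun ω => u (X ω)) P :=
  (hu.mono_ac h.absolutelyContinuous).comp_measurable h.measurable

theorem HasDensity.lintegral_comp (h : HasDensity P X g) {u : E d → ℝ≥0∞}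
    (hu : AEMeasurable u volume) : ∫⁻ ω, u (X ω) ∂P = ∫⁻ x, u x * ENNReal.ofReal (g x) := by
  rw [← lintegral_map' (hu.mono_ac h.absolutelyContinuous) h.measurable.aemeasurable, h.map_eq,
    lintegral_withDensity_eq_lintegral_mul₀ h.aemeasurable_density.ennreal_ofReal hu]
  refine lintegral_congr fun x => ?_
  simp [mul_comm]

theorem HasDensity.eLpNorm_comp_le (h : HasDensity P X g) {f : E d → ℝ} (hf : AEMeasurable f volume)
    {r : ℝ≥0∞} (hr : r ≠ 0) : eLpNorm (fun ω => f (X ω)) r P ≤ weightedNorm r g f := by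
  rcases eq_or_ne r ∞ with rfl | hrt
  · rw [eLpNorm_exponent_top, weightedNorm, if_pos rfl, eLpNormEssSup]
    refine essSup_le_of_ae_le _ ?_
    exact h.ae_comp (ae_le_essSup (f := fun x => ‖f x‖ₑ) (μ := volume))
  · rw [eLpNorm_eq_lintegral_rpow_enorm_toReal hr hrt, weightedNorm, if_neg hrt,
      ← h.lintegral_comp (u := fun x => ‖f x‖ₑ ^ r.toReal) (hf.enorm.pow_const _)]

/-- Markov's inequality, followed by Hölder between the maximal function and the density. -/
theorem HasDensity.mul_measure_lt_maximal_le (h : HasDensity P X g) {p : E d → ℝ≥0∞}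
    (hpm : Measurable p) (hp : ∀ᵐ x, 1 < p x) (hg : varNorm (dualExponent p) (fun x => ‖g x‖ₑ) ≠ ∞)
    {u : E d → ℝ≥0∞} (hu : varNorm p (maximal u) ≠ ∞) (L : ℝ≥0∞) :
    L * P {ω | L < maximal u (X ω)} ≤
      2 * varNorm p (maximal u) * varNorm (dualExponent p) (fun x => ‖g x‖ₑ) := by
  have hM := measurable_maximal u
  calc L * P {ω | L < maximal u (X ω)} ≤ L * P {ω | L ≤ maximal u (X ω)} := by
        gcongr L * P ?_
        exact fun ω (hω : L < maximal u (X ω)) => hω.le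
    _ ≤ ∫⁻ ω, maximal u (X ω) ∂P := mul_meas_ge_le_lintegral (hM.comp h.measurable) L
    _ = ∫⁻ x, maximal u x * ‖g x‖ₑ := by
        rw [h.lintegral_comp hM.aemeasurable]
        simp only [Real.enorm_eq_ofReal (h.nonneg _)]
    _ ≤ _ := lintegral_mul_le_two_mul_varNorm hp hpm hM.aemeasurable hu hg

/-- For `r = ∞` the conventions `toReal ∞ = 0` and `q / 0 = 0` give the intended value 1. -/
theorem theta_eq {q : ℝ} (hq : 0 ≤ q) (r : ℝ≥0∞) : theta q r = 1 - q / r.toReal := by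
  rw [theta, ENNReal.toReal_div, ENNReal.toReal_ofReal hq]

theorem theta_pos {q : ℝ} (hq : 0 < q) {r : ℝ≥0∞} (hr : ENNReal.ofReal q < r) :
    0 < theta q r := by
  rw [theta_eq hq.le]
  rcases eq_or_ne r ∞ with rfl | hrt
  · simp
  · have h := (ENNReal.ofReal_lt_iff_lt_toReal hq.le hrt).1 hr
    rw [sub_pos, div_lt_one (hq.trans h)]
    exact h

theorem setLIntegral_rpow_le_eLpNorm_rpow {W : Ω → ℝ} (hW : AEMeasurable W P) {q : ℝ} (hq : 0 < q)
    {r : ℝ≥0∞} (hr : ENNReal.ofReal q < r) (S : Set Ω) :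
    ∫⁻ ω in S, ‖W ω‖ₑ ^ q ∂P ≤ eLpNorm W r P ^ q * P S ^ theta q r := by
  have hq' : ENNReal.ofReal q ≠ 0 := by simpa using hq
  have h := eLpNorm_le_eLpNorm_mul_rpow_measure_univ (μ := P.restrict S) hr.le
    hW.aestronglyMeasurable.restrict
  rw [eLpNorm_eq_lintegral_rpow_enorm_toReal hq' ENNReal.ofReal_ne_top,
    ENNReal.toReal_ofReal hq.le, Measure.restrict_apply_univ] at h
  have h1 := ENNReal.rpow_le_rpow h hq.le
  rw [← ENNReal.rpow_mul, one_div, inv_mul_cancel₀ hq.ne', ENNReal.rpow_one,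
    ENNReal.mul_rpow_of_nonneg _ _ hq.le, ← ENNReal.rpow_mul, sub_mul, inv_mul_cancel₀ hq.ne',
    one_div, inv_mul_eq_div, ← theta_eq hq.le] at h1
  refine h1.trans ?_
  gcongr
  exact Measure.restrict_le_self

theorem avikainenConstant_lt_top {K A q : ℝ} {r : ℝ≥0∞} {p : E d → ℝ≥0∞} {f : E d → ℝ}
    {G : E d → E d} (hq : 0 < q) (hr : ENNReal.ofReal q < r) (hf : weightedNorm r g f < ∞)
    (hf' : weightedNorm r g' f < ∞) (hg : varNorm (dualExponent p) (fun x => ‖g x‖ₑ) ≠ ∞)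
    (hg' : varNorm (dualExponent p) (fun x => ‖g' x‖ₑ) ≠ ∞)
    (hG : varNorm p (fun x => ‖G x‖ₑ) ≠ ∞) :
    avikainenConstant K A q r p f G g g' < ∞ := by
  have hθ := theta_pos hq hr
  unfold avikainenConstant
  refine ENNReal.add_lt_top.2 ⟨ENNReal.rpow_lt_top_of_nonneg hq.le ENNReal.ofReal_ne_top,
    ENNReal.mul_lt_top (ENNReal.rpow_lt_top_of_nonneg hq.le (ENNReal.add_ne_top.2 ⟨hf.ne, hf'.ne⟩))
      (ENNReal.rpow_lt_top_of_nonneg hθ.le ?_)⟩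
  finiteness

/-- The estimate before the optimization in the truncation level `L` of the maximal function. -/
theorem lintegral_enorm_sub_rpow_le_of_level {p : E d → ℝ≥0∞} (hpm : Measurable p)
    (hp : ∀ᵐ x, 1 < p x) {A : ℝ} (hA : IsMaximalConstant p A) (h : HasDensity P X g)
    (h' : HasDensity P X' g') (hg : varNorm (dualExponent p) (fun x => ‖g x‖ₑ) ≠ ∞)
    (hg' : varNorm (dualExponent p) (fun x => ‖g' x‖ₑ) ≠ ∞) {r : ℝ≥0∞} (hr : 1 < r)
    {f : E d → ℝ} {G : E d → E d} (hf : AEMeasurable f volume)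
    (hG : MemVarLp p (fun x => ‖G x‖)) (hGt : varNorm p (fun x => ‖G x‖ₑ) ≠ ∞)
    {K : ℝ} (hK : IsPointwiseConstant f G K) {q : ℝ} (hq : 0 < q) (hqr : ENNReal.ofReal q < r)
    {L : ℝ≥0∞} (hL0 : L ≠ 0) (hLt : L ≠ ∞) :
    ∫⁻ ω, ‖f (X ω) - f (X' ω)‖ₑ ^ q ∂P ≤
      ENNReal.ofReal (2 * K) ^ q * (L ^ q * ∫⁻ ω, ‖X ω - X' ω‖ₑ ^ q ∂P) +
      (weightedNorm r g f + weightedNorm r g' f) ^ q *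
        (2 * ENNReal.ofReal A * (varNorm (dualExponent p) (fun x => ‖g x‖ₑ) +
          varNorm (dualExponent p) (fun x => ‖g' x‖ₑ)) * varNorm p (fun x => ‖G x‖ₑ)) ^ theta q r *
        L ^ (-theta q r) := by
  have hθ := theta_pos hq hqr
  set M := maximal (fun z => ‖G z‖ₑ) with hM
  have hMm : Measurable M := measurable_maximal _
  have hMn : varNorm p M ≤ ENNReal.ofReal A * varNorm p (fun x => ‖G x‖ₑ) := by
    simpa only [enorm_norm] using hA.2 (fun x => ‖G x‖) hG
  have hMt : varNorm p M ≠ ∞ :=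
    ne_top_of_le_ne_top (ENNReal.mul_ne_top ENNReal.ofReal_ne_top hGt) hMn
  -- The bad set: off it both maximal functions are at most `L`, so the pointwise estimate becomes a
  -- Lipschitz bound.
  set S : Set Ω := {ω | L < M (X ω)} ∪ {ω | L < M (X' ω)} with hS
  have hSm : MeasurableSet S :=
    (measurableSet_lt measurable_const (hMm.comp h.measurable)).union
      (measurableSet_lt measurable_const (hMm.comp h'.measurable))
  have hW : AEMeasurable (fun ω => f (X ω)) P := h.aemeasurable_comp hf
  have hW' : AEMeasurable (fun ω => f (X' ω)) P := h'.aemeasurable_comp hf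
  have hr0 : r ≠ 0 := (one_pos.trans hr).ne'
  have hnorm : eLpNorm (fun ω => f (X ω) - f (X' ω)) r P ≤
      weightedNorm r g f + weightedNorm r g' f :=
    (eLpNorm_sub_le hW.aestronglyMeasurable hW'.aestronglyMeasurable hr.le).trans
      (add_le_add (h.eLpNorm_comp_le hf hr0) (h'.eLpNorm_comp_le hf hr0))
  set Q := 2 * ENNReal.ofReal A * (varNorm (dualExponent p) (fun x => ‖g x‖ₑ) +
    varNorm (dualExponent p) (fun x => ‖g' x‖ₑ)) * varNorm p (fun x => ‖G x‖ₑ) with hQ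
  have hPS : P S ≤ Q * L⁻¹ := by
    rw [← div_eq_mul_inv, ENNReal.le_div_iff_mul_le (Or.inl hL0) (Or.inl hLt), mul_comm]
    calc L * P S ≤ L * (P {ω | L < M (X ω)} + P {ω | L < M (X' ω)}) := by
          gcongr
          exact measure_union_le _ _
      _ = L * P {ω | L < M (X ω)} + L * P {ω | L < M (X' ω)} := mul_add _ _ _
      _ ≤ 2 * varNorm p M * varNorm (dualExponent p) (fun x => ‖g x‖ₑ) +
          2 * varNorm p M * varNorm (dualExponent p) (fun x => ‖g' x‖ₑ) :=
          add_le_add (h.mul_measure_lt_maximal_le hpm hp hg hMt L)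
            (h'.mul_measure_lt_maximal_le hpm hp hg' hMt L)
      _ = 2 * varNorm p M * (varNorm (dualExponent p) (fun x => ‖g x‖ₑ) +
          varNorm (dualExponent p) (fun x => ‖g' x‖ₑ)) := (mul_add _ _ _).symm
      _ ≤ 2 * (ENNReal.ofReal A * varNorm p (fun x => ‖G x‖ₑ)) *
          (varNorm (dualExponent p) (fun x => ‖g x‖ₑ) +
          varNorm (dualExponent p) (fun x => ‖g' x‖ₑ)) := by gcongr
      _ = Q := by rw [hQ]; ring
  have hbad : ∫⁻ ω in S, ‖f (X ω) - f (X' ω)‖ₑ ^ q ∂P ≤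
      (weightedNorm r g f + weightedNorm r g' f) ^ q * Q ^ theta q r * L ^ (-theta q r) := by
    calc _ ≤ _ := setLIntegral_rpow_le_eLpNorm_rpow (hW.sub hW') hq hqr S
      _ ≤ (weightedNorm r g f + weightedNorm r g' f) ^ q * (Q * L⁻¹) ^ theta q r :=
          mul_le_mul' (ENNReal.rpow_le_rpow hnorm hq.le) (ENNReal.rpow_le_rpow hPS hθ.le)
      _ = _ := by
          rw [ENNReal.mul_rpow_of_nonneg _ _ hθ.le, ENNReal.inv_rpow, ← ENNReal.rpow_neg,
            mul_assoc]
  have hgood : ∫⁻ ω in Sᶜ, ‖f (X ω) - f (X' ω)‖ₑ ^ q ∂P ≤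
      ENNReal.ofReal (2 * K) ^ q * (L ^ q * ∫⁻ ω, ‖X ω - X' ω‖ₑ ^ q ∂P) := by
    obtain ⟨hK0, N, -, hN0, hN⟩ := hK
    have hNae : ∀ᵐ x, x ∉ N := measure_eq_zero_iff_ae_notMem.1 hN0
    have hpt : ∀ᵐ ω ∂P, ω ∈ Sᶜ → ‖f (X ω) - f (X' ω)‖ₑ ^ q ≤
        ENNReal.ofReal (2 * K) ^ q * L ^ q * ‖X ω - X' ω‖ₑ ^ q := by
      filter_upwards [h.ae_comp hNae, h'.ae_comp hNae] with ω hω hω' hωS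
      rw [hS, mem_compl_iff, mem_union, not_or] at hωS
      have h1 : M (X ω) ≤ L := not_lt.1 hωS.1
      have h2 : M (X' ω) ≤ L := not_lt.1 hωS.2
      rw [← ENNReal.mul_rpow_of_nonneg _ _ hq.le, ← ENNReal.mul_rpow_of_nonneg _ _ hq.le]
      refine ENNReal.rpow_le_rpow ?_ hq.le
      rw [Real.enorm_eq_ofReal_abs]
      calc _ ≤ _ := hN _ hω _ hω'
        _ ≤ ENNReal.ofReal (K * ‖X ω - X' ω‖) * (L + L) := by
            gcongr
            · exact (restrictedMaximal_le_maximal _ _ _).trans h1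
            · exact (restrictedMaximal_le_maximal _ _ _).trans h2
        _ = _ := by
            rw [ENNReal.ofReal_mul hK0.le, ENNReal.ofReal_mul two_pos.le, ofReal_norm,
              ENNReal.ofReal_ofNat]
            ring
    calc _ ≤ ∫⁻ ω in Sᶜ, ENNReal.ofReal (2 * K) ^ q * L ^ q * ‖X ω - X' ω‖ₑ ^ q ∂P :=
          lintegral_mono_ae ((ae_restrict_iff' hSm.compl).2 hpt)
      _ ≤ ∫⁻ ω, ENNReal.ofReal (2 * K) ^ q * L ^ q * ‖X ω - X' ω‖ₑ ^ q ∂P :=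
          setLIntegral_le_lintegral _ _
      _ = _ := by
          rw [lintegral_const_mul' _ _ (ENNReal.mul_ne_top
            (ENNReal.rpow_lt_top_of_nonneg hq.le ENNReal.ofReal_ne_top).ne
            (ENNReal.rpow_lt_top_of_nonneg hq.le hLt).ne), mul_assoc]
  rw [← lintegral_add_compl _ hSm, add_comm]
  exact add_le_add hgood hbad

theorem lintegral_enorm_sub_rpow_le {p : E d → ℝ≥0∞} (hpm : Measurable p)
    (hp : ∀ᵐ x, 1 < p x) {A : ℝ} (hA : IsMaximalConstant p A) (h : HasDensity P X g)
    (h' : HasDensity P X' g') (hg : varNorm (dualExponent p) (fun x => ‖g x‖ₑ) ≠ ∞)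
    (hg' : varNorm (dualExponent p) (fun x => ‖g' x‖ₑ) ≠ ∞) {r : ℝ≥0∞} (hr : 1 < r)
    {f : E d → ℝ} {G : E d → E d} (hf : AEMeasurable f volume)
    (hG : MemVarLp p (fun x => ‖G x‖)) (hGt : varNorm p (fun x => ‖G x‖ₑ) ≠ ∞)
    {K : ℝ} (hK : IsPointwiseConstant f G K) {q : ℝ} (hq : 0 < q) (hqr : ENNReal.ofReal q < r) :
    ∫⁻ ω, ‖f (X ω) - f (X' ω)‖ₑ ^ q ∂P ≤
      avikainenConstant K A q r p f G g g' *
        (∫⁻ ω, ‖X ω - X' ω‖ₑ ^ q ∂P) ^ (theta q r / (q + theta q r)) := by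
  have hθ := theta_pos hq hqr
  set δ := ∫⁻ ω, ‖X ω - X' ω‖ₑ ^ q ∂P with hδ
  have hs : 0 < q + theta q r := add_pos hq hθ
  rcases eq_or_ne δ 0 with h0 | h0
  · have hm : Measurable fun ω => ‖X ω - X' ω‖ₑ ^ q :=
      (h.measurable.sub h'.measurable).enorm.pow_const q
    rw [hδ, lintegral_eq_zero_iff hm] at h0
    refine le_of_eq_of_le ?_ zero_le
    rw [← lintegral_zero (μ := P)]
    refine lintegral_congr_ae (h0.mono fun ω hω => ?_)
    have h1 : ‖X ω - X' ω‖ₑ ^ q = 0 := hω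
    rw [ENNReal.rpow_eq_zero_iff_of_pos hq, enorm_eq_zero, sub_eq_zero] at h1
    simp [h1, hq]
  rcases eq_or_ne δ ∞ with ht | ht
  -- The right side is infinite here, since the constant is at least `(2K)^q > 0`.
  · rw [ht, ENNReal.top_rpow_of_pos (div_pos hθ hs), ENNReal.mul_top]
    · exact le_top
    · have h1 : ENNReal.ofReal (2 * K) ^ q ≠ 0 := by
        rw [Ne, ENNReal.rpow_eq_zero_iff_of_pos hq, ENNReal.ofReal_eq_zero, not_le]
        linarith [hK.1]
      exact (pos_iff_ne_zero.2 h1 |>.trans_le le_self_add).ne'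
  -- The level equalising `L^q δ` and `L^(-θ)`; both become `δ^(θ/(q+θ))`.
  set L := δ ^ (-(q + theta q r)⁻¹) with hL
  have hL0 : L ≠ 0 := (ENNReal.rpow_pos (pos_iff_ne_zero.2 h0) ht).ne'
  have hLt : L ≠ ∞ := ENNReal.rpow_ne_top_of_ne_zero h0 ht
  have h1 : L ^ q * δ = δ ^ (theta q r / (q + theta q r)) := by
    calc L ^ q * δ = δ ^ (-(q + theta q r)⁻¹ * q) * δ ^ (1 : ℝ) := by
          rw [hL, ENNReal.rpow_mul, ENNReal.rpow_one]
      _ = _ := by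
          rw [← ENNReal.rpow_add _ _ h0 ht]
          congr 1
          field_simp
          ring
  have h2 : L ^ (-theta q r) = δ ^ (theta q r / (q + theta q r)) := by
    rw [hL, ← ENNReal.rpow_mul]
    congr 1
    field_simp
  have h3 := lintegral_enorm_sub_rpow_le_of_level hpm hp hA h h' hg hg' hr hf hG hGt hK hq hqr
    hL0 hLt
  rw [← hδ, h1, h2, ← add_mul] at h3
  exact h3

end Density

end VariableExponent

theorem theorem2p21 (d : ℕ) (hd : 1 ≤ d) :
    -- constants of the pointwise estimate exist, with one that depends only on the dimension
    (∃ K₀ : ℝ, ∀ (f : E d → ℝ) (G : E d → E d),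
      HasWeakGradient f G → IsPointwiseConstant f G K₀) ∧
    ∀ p : E d → ℝ≥0∞, IsLogHolderExponent p → 1 < essInf p volume →
      -- constants of the maximal inequality exist
      (∃ A : ℝ, IsMaximalConstant p A) ∧
      -- the estimate holds with any such constants
      ∀ A : ℝ, IsMaximalConstant p A →
      ∀ (Ω : Type*) [MeasurableSpace Ω] (P : Measure Ω) [IsProbabilityMeasure P]
        (X X' : Ω → E d) (pX pX' : E d → ℝ),
        HasDensity P X pX → HasDensity P X' pX' →
        MemVarLp (dualExponent p) pX → MemVarLp (dualExponent p) pX' →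
      ∀ r : ℝ≥0∞, 1 < r →
      ∀ (f : E d → ℝ) (G : E d → E d),
        MemSobolev p f → HasWeakGradient f G →
        MemWeightedLp r pX f → MemWeightedLp r pX' f →
      ∀ K₀ : ℝ, IsPointwiseConstant f G K₀ →
      ∀ q : ℝ, 0 < q → ENNReal.ofReal q < r →
        avikainenConstant K₀ A q r p f G pX pX' < ∞ ∧
        ∫⁻ ω, ‖f (X ω) - f (X' ω)‖ₑ ^ q ∂P ≤
          avikainenConstant K₀ A q r p f G pX pX' *
            (∫⁻ ω, ‖X ω - X' ω‖ₑ ^ q ∂P) ^ (theta q r / (q + theta q r)) := by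
  refine ⟨⟨8 ^ d, fun f G h => h.isPointwiseConstant⟩, fun p hp hp1 =>
    ⟨exists_isMaximalConstant hd hp hp1, ?_⟩⟩
  intro A hA Ω _ P _ X X' pX pX' hX hX' hpX hpX' r hr f G hf hG hfr hfr' K₀ hK q hq hqr
  have hp1' : ∀ᵐ x, 1 < p x := (ae_essInf_le (f := p)).mono fun x hx => hp1.trans_le hx
  have hgX := hpX.varNorm_ne_top (one_le_dualExponent p)
  have hgX' := hpX'.varNorm_ne_top (one_le_dualExponent p)
  have hGp := hf.memVarLp_norm hG
  have hGt : varNorm p (fun x => ‖G x‖ₑ) ≠ ∞ := by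
    simpa only [enorm_norm] using hGp.varNorm_ne_top hp.isExponent.one_le
  exact ⟨avikainenConstant_lt_top hq hqr hfr.2 hfr'.2 hgX hgX' hGt,
    lintegral_enorm_sub_rpow_le hp.isExponent.measurable hp1' hA hX hX' hgX hgX' hr hfr.1 hGp hGt
      hK hq hqr⟩
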